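/- **Formulas.** A cnf-xor formula $\phi=\phi_{\rm or}\wedge\phi_{\rm xor}$ is a finite conjunction of clauses and of xor-constraints $x_1\oplus\dots\oplus x_k\equiv p$ (the $x_i$ distinct variables, $p\in\{\bot,\top\}$). Its size counts each clause and each xor-constraint as one plus its number of literals, respectively variables. Let $\operatorname{cnf}(D)$ be the straightforward CNF translation of $D$ (all clauses over exactly the variables of $D$ that exclude one assignment violating $D$), and $\operatorname{cnf}(\phi)=\phi_{\rm or}\wedge\bigwedge_{D\in\phi_{\rm xor}}\operatorname{cnf}(D)$. A resolution refutation of $\operatorname{cnf}(\phi)$ of size $s$ is a resolution derivation of $s$ clauses containing the empty clause. The literals $x$, $\neg x$ are identified with $x\equiv\top$, $x\equiv\bot$. **Subst and EC.** $D[x/Y]$ denotes $D$ with $x$ replaced by $Y$, duplicate variables being cancelled. The rules of Subst, where $x$ occurs in $D$ and $y\ne x$, are: from $x\equiv p$ and $D$ infer $D[x/p]$; from $x\oplus y\equiv p$ and $D$ infer $D[x/y\oplus p]$. The rules of EC are: from $x\equiv p$ and $D\ni x$ infer $D[x/p]$; from $D$ containing distinct variables $x,y$ and a path of binary constraints $x\oplus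 x_1\equiv p_1,\ x_1\oplus x_2\equiv p_2,\dots,\ x_{n-1}\oplus y\equiv p_n$, $n\ge1$ (each binary constraint on two distinct variables), infer $D[x/y\oplus p]$ with $p=p_1\oplus\dots\oplus p_n$. A derivation on a conjunction $\psi$ is a finite DAG with vertices labelled by xor-constraints; vertices without incoming edges (inputs) are labelled by members of $\psi$, and every other label follows by one rule from the labels of the sources of its incoming edges. The size of a derivation is its number of vertices plus edges. **Explanations.** Let $G$ be a derivation on $\phi_{\rm xor}\wedge l_1\wedge\dots\wedge l_k$ with literals (xor-assumptions) $l_i$. A cut for a non-input vertex $v$ is a partition $(V_a,V_b)$ of the vertices with $v\in V_b$ and all inputs from which $v$ is reachable in $V_a$. It is cnf-compatible if each vertex in $V_a$ with an edge into $V_b$ is an input from $\phi_{\rm xor}$ or is labelled by a literal. The implicative explanation $f(v)$ is defined recursively: $f(u)=\top$ for an input $u$ with label in $\phi_{\rm xor}$; $f(u)$ is the label of $u$ for every other input and every non-input $u\in V_a$; $f(u)$ is the conjunction of $f$ over the sources of the edges into $u$ for every non-input $u\in V_b$. Given a set $T$ of currently true literals, the module can report the clause $f(v)\Rightarrow \mathrm{label}(v)$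 whenever all $l_i$ are in $T$, the cut is cnf-compatible, $f(v)$ is a conjunction of literals in $T$, and the label of $v$ is a literal (xor-implied literal) or $\bot\equiv\top$ (xor-conflict). A member of $\phi_{\rm xor}$ that is itself a literal or $\bot\equiv\top$ is reported with explanation $\top$. **The solver.** A DPLL(XOR) solver keeps a trail of assigned literals, each either a decision or carrying a reason clause, and a clause database, initially $\phi_{\rm or}$. Nondeterministically it may: - decide an unassigned literal over a variable of $\phi$; - assign the only non-false, unassigned literal of a database clause or of a clause reported by the module, with that clause as reason; - start conflict analysis with a database clause or reported clause that is false; - in conflict analysis, remove the latest trail literal $l$ if $\neg l$ is not in the conflict clause, or, if $\neg l$ is in it and $l$ has a reason, remove $l$ and replace the conflict clause by its resolvent with that reason; - learn the conflict clause when it contains $\neg l$ for the latest trail literal $l$ and all its other literals are false on the part of the trail before some decision; it is added to the database, and the trail is cut back to just before that decision; - restart, which undoes all decisions and everything assigned after the first decision; - answer "unsatisfiable" when the conflict clause is empty. An eager solver decides only when no database clause and no clause that the module can report is false or has exactly one unassigned and otherwise only false literals; a non-eager solver may decide at any time. A refutation of $\phi$ is a run from the empty trail to "unsatisfiable". Its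 size is its number of transitions plus the sizes of the derivations used for reported clauses. **Statement.** For every $w\in\mathbb N$ there is a polynomial $p$ (with coefficients in $\mathbb N$, depending only on $w$) such that for each of the two modules Subst and EC, for the eager and the non-eager solver, and for every cnf-xor formula $\phi$ all of whose xor-constraints have at most $w$ variables: 1. if the solver has a refutation of $\phi$ of size $s$, then $\operatorname{cnf}(\phi)$ has a resolution refutation of size at most $p(|\phi|+s)$; 2. if $\operatorname{cnf}(\phi)$ has a resolution refutation of size $s$, then the solver has a refutation of $\phi$ of size at most $p(|\phi|+s)$. That is, for cnf-xor formulas with xor-constraints of fixed width, the proof system underlying a DPLL(XOR) solver with Subst or EC as xor-reasoning module is polynomially equivalent to resolution. -/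

import Mathlib

namespace DpllXor

/-! ### Literals, clauses, resolution -/

/-- A literal over the variables `V`: the variable `x` (`sign = true`) or its negation
`¬ x` (`sign = false`). -/
@[ext] structure Lit (V : Type*) where
  var : V
  sign : Bool
deriving DecidableEq

/-- Negation of literals, with `¬ ¬ l = l`. -/
def Lit.neg {V : Type*} (l : Lit V) : Lit V := ⟨l.var, !l.sign⟩

/-- A clause, that is, a finite disjunction of literals. -/
abbrev Clause (V : Type*) := Finset (Lit V)

/-- The resolvent `C ∨ D` of the clauses `l ∨ C` and `¬ l ∨ D`. -/
def resolvent {V : Type*} [DecidableEq V] (A B : Clause V) (l : Lit V) : Clause V :=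
  A.erase l ∪ B.erase l.neg

/-- `π` is a resolution derivation on the CNF formula `F`: every clause of the sequence is
a clause of `F` or the resolvent of two earlier clauses. -/
def IsResolutionDerivation {V : Type*} [DecidableEq V] (F : Finset (Clause V))
    (π : List (Clause V)) : Prop :=
  ∀ (i : ℕ) (hi : i < π.length), π[i] ∈ F ∨
    ∃ (j k : ℕ) (hj : j < i) (hk : k < i) (x : V),
      (⟨x, true⟩ : Lit V) ∈ π[j] ∧ (⟨x, false⟩ : Lit V) ∈ π[k] ∧
      π[i] = resolvent π[j] π[k] ⟨x, true⟩

/-- `F` has a resolution refutation consisting of `s` clauses. -/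
def ResolutionRefutes {V : Type*} [DecidableEq V] (F : Finset (Clause V)) (s : ℕ) : Prop :=
  ∃ π : List (Clause V), IsResolutionDerivation F π ∧ ∅ ∈ π ∧ π.length = s

/-! ### Xor-constraints and cnf-xor formulas -/

/-- The xor-constraint `x₁ ⊕ ⋯ ⊕ xₖ ≡ parity` with `vars = {x₁, …, xₖ}` (duplicate variables
already cancelled). -/
@[ext] structure XorConstraint (V : Type*) where
  vars : Finset V
  parity : Bool
deriving DecidableEq

/-- The contradiction `⊥ ≡ ⊤`. -/
def XorConstraint.bot (V : Type*) : XorConstraint V := ⟨∅, true⟩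

/-- The literal `x` is identified with `x ≡ ⊤` and `¬ x` with `x ≡ ⊥`. -/
def Lit.toXor {V : Type*} (l : Lit V) : XorConstraint V := ⟨{l.var}, l.sign⟩

/-- `D.subst x Y q` is obtained from `D` by substituting the sum `y₁ ⊕ ⋯ ⊕ yₘ ⊕ q`, where
`Y = {y₁, …, yₘ}`, for the variable `x`; variables that now occur twice cancel. -/
def XorConstraint.subst {V : Type*} [DecidableEq V] (D : XorConstraint V) (x : V)
    (Y : Finset V) (q : Bool) : XorConstraint V :=
  if x ∈ D.vars then ⟨symmDiff (D.vars.erase x) Y, xor D.parity q⟩ else D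

/-- The straightforward CNF translation of `D`: for each assignment of the variables of `D`
that violates `D` (it makes exactly the variables in `S` true, and `S.card` has the wrong
parity), the clause over all variables of `D` that excludes this assignment. -/
def XorConstraint.cnf {V : Type*} [DecidableEq V] (D : XorConstraint V) : Finset (Clause V) :=
  (D.vars.powerset.filter fun S => decide (Odd S.card) ≠ D.parity).image fun S =>
    D.vars.image fun x => ⟨x, decide (x ∉ S)⟩

/-- A cnf-xor formula: a conjunction of clauses and a conjunction of xor-constraints. -/
structure CnfXor (V : Type*) where
  clauses : Finset (Clause V)
  xors : Finset (XorConstraint V)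

/-- The variables that occur in the formula. -/
def CnfXor.vars {V : Type*} [DecidableEq V] (φ : CnfXor V) : Finset V :=
  (φ.clauses.biUnion fun C => C.image Lit.var) ∪ φ.xors.biUnion XorConstraint.vars

/-- The size of the formula: each clause and each xor-constraint counts one plus the number
of its literals, respectively variables. -/
def CnfXor.size {V : Type*} (φ : CnfXor V) : ℕ :=
  (∑ C ∈ φ.clauses, (1 + C.card)) + ∑ D ∈ φ.xors, (1 + D.vars.card)

/-- All xor-constraints have at most `w` variables. -/
def CnfXor.XorWidthLE {V : Type*} (φ : CnfXor V) (w : ℕ) : Prop :=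
  ∀ D ∈ φ.xors, D.vars.card ≤ w

/-- The CNF translation of a cnf-xor formula. -/
def CnfXor.toCnf {V : Type*} [DecidableEq V] (φ : CnfXor V) : Finset (Clause V) :=
  φ.clauses ∪ φ.xors.biUnion XorConstraint.cnf

/-! ### The deduction systems Subst and EC -/

/-- The inference rules of Subst; the premises are listed in order. -/
inductive SubstRule {V : Type*} [DecidableEq V] :
    List (XorConstraint V) → XorConstraint V → Prop
  | unitPos (x : V) (D : XorConstraint V) (hx : x ∈ D.vars) :
      SubstRule [⟨{x}, true⟩, D] (D.subst x ∅ true)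
  | unitNeg (x : V) (D : XorConstraint V) (hx : x ∈ D.vars) :
      SubstRule [⟨{x}, false⟩, D] (D.subst x ∅ false)
  | eqvPos (x y : V) (D : XorConstraint V) (hxy : x ≠ y) (hx : x ∈ D.vars) :
      SubstRule [⟨{x, y}, false⟩, D] (D.subst x {y} false)
  | eqvNeg (x y : V) (D : XorConstraint V) (hxy : x ≠ y) (hx : x ∈ D.vars) :
      SubstRule [⟨{x, y}, true⟩, D] (D.subst x {y} true)

/-- `EqvPath x y p L`: the list `L` consists of binary xor-constraints
`x ⊕ x₁ ≡ p₁`, `x₁ ⊕ x₂ ≡ p₂`, …, `xₙ₋₁ ⊕ y ≡ pₙ` with `n ≥ 1` and `p = p₁ ⊕ ⋯ ⊕ pₙ`, so that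
`x` and `y` are in one equivalence class, with `x ⊕ y ≡ p`. -/
inductive EqvPath {V : Type*} [DecidableEq V] :
    V → V → Bool → List (XorConstraint V) → Prop
  | single (x y : V) (p : Bool) (hxy : x ≠ y) : EqvPath x y p [⟨{x, y}, p⟩]
  | cons (x y z : V) (p q : Bool) (L : List (XorConstraint V)) (hxy : x ≠ y)
      (h : EqvPath y z q L) : EqvPath x z (xor p q) (⟨{x, y}, p⟩ :: L)

/-- The inference rules of the equivalence class system EC.

* `unit`: from `x ≡ p` and a constraint in which `x` occurs, the latter with `x` replaced by `p`.
* `path`: from a constraint `D` in which two distinct variables `x` and `y` occur and a path of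
  binary constraints that yields `x ⊕ y ≡ p`, the constraint `D` with `x` replaced by `y ⊕ p`,
  so that `x` and `y` both disappear.

On constraints with at most three variables these are the usual rules: `unit` is the
conflict rule for `x ≡ p, x ≡ ¬ p` and unit propagation in binary and in ternary constraints, and
`path` is the implication of a literal by a ternary constraint two of whose variables are in one
equivalence class, and the conflict rule for a cycle of binary constraints of odd parity. -/
inductive ECRule {V : Type*} [DecidableEq V] :
    List (XorConstraint V) → XorConstraint V → Prop
  | unit (x : V) (p : Bool) (D : XorConstraint V) (hx : x ∈ D.vars) :
      ECRule [⟨{x}, p⟩, D] (D.subst x ∅ p)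
  | path (x y : V) (p : Bool) (L : List (XorConstraint V)) (D : XorConstraint V)
      (hL : EqvPath x y p L) (hxy : x ≠ y) (hx : x ∈ D.vars) (hy : y ∈ D.vars) :
      ECRule (D :: L) (D.subst x {y} p)

/-- The two xor-reasoning modules. -/
inductive XorModule
  | subst
  | ec

/-- The inference rules of a module. -/
def XorModule.Rule {V : Type*} [DecidableEq V] :
    XorModule → List (XorConstraint V) → XorConstraint V → Prop
  | .subst => SubstRule
  | .ec => ECRule

/-- A derivation of the module `M` on the conjunction `ψ`: a finite directed acyclic graph whose
vertices are labelled with xor-constraints. The vertices are numbered in a topological order: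
`prem v` lists the sources of the edges into `v`, all of them smaller than `v`. Input vertices have
no incoming edges and carry a label from `ψ`; every other label follows from the labels of the
sources by one inference rule. -/
structure XorDerivation {V : Type*} [DecidableEq V] (M : XorModule)
    (ψ : Finset (XorConstraint V)) where
  n : ℕ
  label : Fin n → XorConstraint V
  prem : (v : Fin n) → List (Fin v)
  valid : ∀ v : Fin n,
    (prem v = [] ∧ label v ∈ ψ) ∨
    (prem v ≠ [] ∧ M.Rule ((prem v).map fun u : Fin v => label ⟨u, u.2.trans v.2⟩) (label v))

namespace XorDerivation

variable {V : Type*} [DecidableEq V] {M : XorModule} {ψ : Finset (XorConstraint V)}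

/-- The number of vertices and edges. -/
def size (G : XorDerivation M ψ) : ℕ :=
  ∑ v : Fin G.n, (1 + (G.prem v).length)

/-- `v` has no incoming edges. -/
def IsInput (G : XorDerivation M ψ) (v : Fin G.n) : Prop := G.prem v = []

/-- There is an edge from `u` to `v`. -/
def Edge (G : XorDerivation M ψ) (u v : Fin G.n) : Prop :=
  ∃ w ∈ G.prem v, (w : ℕ) = u

/-- The partition of the vertices into `Va` and its complement is a cut for the
vertex `v`. -/
def IsCutFor (G : XorDerivation M ψ) (Va : Set (Fin G.n)) (v : Fin G.n) : Prop :=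
  v ∉ Va ∧ ∀ u, G.IsInput u → Relation.TransGen G.Edge u v → u ∈ Va

/-- The cut is cnf-compatible: each vertex of `Va` with an edge to a vertex outside `Va` is
an input vertex from `φxor` or has a label with exactly one variable. -/
def IsCnfCompatible (G : XorDerivation M ψ) (φxor : Finset (XorConstraint V))
    (Va : Set (Fin G.n)) : Prop :=
  ∀ u ∈ Va, ∀ v ∉ Va, G.Edge u v →
    (G.IsInput u ∧ G.label u ∈ φxor) ∨ (G.label u).vars.card = 1

open scoped Classical in
/-- The implicative explanation of the vertex `v` under the cut `Va`, as the set of its conjuncts: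
empty for an input vertex from `φxor`, the label itself for any other input vertex and for
the other vertices in `Va`, and the union of the explanations of the premises for the
remaining vertices. -/
noncomputable def expl (G : XorDerivation M ψ) (φxor : Finset (XorConstraint V))
    (Va : Set (Fin G.n)) (v : Fin G.n) : Finset (XorConstraint V) :=
  if G.IsInput v then (if G.label v ∈ φxor then ∅ else {G.label v})
  else if v ∈ Va then {G.label v}
  else (G.prem v).foldr (fun (u : Fin v) acc => G.expl φxor Va ⟨u, u.2.trans v.2⟩ ∪ acc) ∅
termination_by (v : ℕ)
decreasing_by exact u.2

end XorDerivation

/-- `Reports M φxor T C k`: when the literals in `T` are assigned, the module `M` initialized with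
`φxor` can report the clause `C` as a clausal explanation, by means of a derivation of size `k`.
The derivation is on `φxor` and xor-assumptions `A ⊆ T`, and `C` is `⋀ L ⇒ label v` for a vertex
`v` labelled with a literal (then `C` explains an xor-implied literal) or with `⊥ ≡ ⊤` (then `C`
explains an xor-conflict), where `⋀ L` is the implicative explanation of `v`
under a cnf-compatible cut for `v`, all of whose literals are already assigned.
A constraint of `φxor` that is itself a literal or `⊥ ≡ ⊤` is reported
with the empty explanation. -/
def Reports {V : Type*} [DecidableEq V] (M : XorModule) (φxor : Finset (XorConstraint V))
    (T : Set (Lit V)) (C : Clause V) (k : ℕ) : Prop :=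
  ∃ (A : Finset (Lit V)) (G : XorDerivation M (φxor ∪ A.image Lit.toXor))
    (Va : Set (Fin G.n)) (v : Fin G.n) (L : Finset (Lit V)),
    (∀ a ∈ A, a ∈ T) ∧ G.size = k ∧
    ((G.IsInput v ∧ G.label v ∈ φxor) ∨
      (¬ G.IsInput v ∧ G.IsCutFor Va v ∧ G.IsCnfCompatible φxor Va)) ∧
    G.expl φxor Va v = L.image Lit.toXor ∧ (∀ l ∈ L, l ∈ T) ∧
    ((∃ l : Lit V, G.label v = l.toXor ∧ C = insert l (L.image Lit.neg)) ∨
      (G.label v = XorConstraint.bot V ∧ C = L.image Lit.neg))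

/-! ### The DPLL(XOR) solver -/

/-- A trail: the assigned literals, latest first, each with its reason clause;
decision literals have the reason `none`. -/
abbrev Trail (V : Type*) := List (Lit V × Option (Clause V))

/-- The literals that are true on the trail. -/
def Trail.lits {V : Type*} (t : Trail V) : Set (Lit V) := {l | l ∈ t.map Prod.fst}

/-- Neither the literal nor its negation is true on the trail. -/
def Trail.Unassigned {V : Type*} (t : Trail V) (l : Lit V) : Prop :=
  l ∉ t.lits ∧ l.neg ∉ t.lits

/-- All literals of the clause are false on the trail. -/
def Trail.Falsifies {V : Type*} (t : Trail V) (C : Clause V) : Prop :=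
  ∀ l ∈ C, l.neg ∈ t.lits

/-- The clause is unit on the trail, with `l` its only literal that is not false. -/
def Trail.MakesUnit {V : Type*} (t : Trail V) (C : Clause V) (l : Lit V) : Prop :=
  l ∈ C ∧ t.Unassigned l ∧ ∀ l' ∈ C, l' ≠ l → l'.neg ∈ t.lits

/-- The states of the solver: search with a trail and a clause database; conflict analysis with a
trail, a database and the current conflict clause; the answer "unsatisfiable". -/
inductive State (V : Type*)
  | search (t : Trail V) (db : Finset (Clause V))
  | analyze (t : Trail V) (db : Finset (Clause V)) (C : Clause V)
  | unsat

/-- Propagation is complete and without a conflict: no clause of the database and no clause that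
the xor-reasoning module can report is false or unit on the trail. -/
def Saturated {V : Type*} [DecidableEq V] (M : XorModule) (φ : CnfXor V) (t : Trail V)
    (db : Finset (Clause V)) : Prop :=
  ∀ C : Clause V, (C ∈ db ∨ ∃ k, Reports M φ.xors t.lits C k) →
    ¬ t.Falsifies C ∧ ∀ l, ¬ t.MakesUnit C l

/-- The transitions `σ ⟶ τ` of the solver with the xor-reasoning module `M` on `φ`, with their costs;
in `Step M φ eager σ k τ` the cost is `k`. An `eager` solver branches only when
propagation is complete; otherwise it may branch at any time. -/
inductive Step {V : Type*} [DecidableEq V] (M : XorModule) (φ : CnfXor V) (eager : Bool) :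
    State V → ℕ → State V → Prop
  /-- branching -/
  | decide (t : Trail V) (db : Finset (Clause V)) (l : Lit V)
      (hv : l.var ∈ φ.vars) (hl : t.Unassigned l) (hs : eager = true → Saturated M φ t db) :
      Step M φ eager (.search t db) 1 (.search ((l, none) :: t) db)
  /-- unit propagation in the CNF part -/
  | propagate (t : Trail V) (db : Finset (Clause V)) (C : Clause V) (l : Lit V)
      (hC : C ∈ db) (hl : t.MakesUnit C l) :
      Step M φ eager (.search t db) 1 (.search ((l, some C) :: t) db)
  /-- an xor-implied literal with its clausal explanation -/
  | xorPropagate (t : Trail V) (db : Finset (Clause V)) (C : Clause V) (l : Lit V) (k : ℕ)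
      (hC : Reports M φ.xors t.lits C k) (hl : t.MakesUnit C l) :
      Step M φ eager (.search t db) (1 + k) (.search ((l, some C) :: t) db)
  /-- conflict in the CNF part -/
  | conflict (t : Trail V) (db : Finset (Clause V)) (C : Clause V)
      (hC : C ∈ db) (hf : t.Falsifies C) :
      Step M φ eager (.search t db) 1 (.analyze t db C)
  /-- xor-conflict with its clausal explanation -/
  | xorConflict (t : Trail V) (db : Finset (Clause V)) (C : Clause V) (k : ℕ)
      (hC : Reports M φ.xors t.lits C k) (hf : t.Falsifies C) :
      Step M φ eager (.search t db) (1 + k) (.analyze t db C)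
  /-- conflict analysis: the latest literal of the trail plays no role in the conflict -/
  | skip (t : Trail V) (db : Finset (Clause V)) (C : Clause V) (l : Lit V)
      (r : Option (Clause V)) (hl : l.neg ∉ C) :
      Step M φ eager (.analyze ((l, r) :: t) db C) 1 (.analyze t db C)
  /-- conflict analysis: resolve with the reason of the latest literal of the trail -/
  | resolve (t : Trail V) (db : Finset (Clause V)) (C R : Clause V) (l : Lit V)
      (hl : l.neg ∈ C) :
      Step M φ eager (.analyze ((l, some R) :: t) db C) 1 (.analyze t db (resolvent R C l))
  /-- learn the conflict clause once it is asserting, that is, all its literals except the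
  latest are false at lower decision levels, and jump back before a decision `d` in such a way that
  the learned clause is unit -/
  | learn (t t' p : Trail V) (db : Finset (Clause V)) (C : Clause V) (l d : Lit V)
      (r : Option (Clause V)) (hl : l.neg ∈ C) (ht : (l, r) :: t = p ++ (d, none) :: t')
      (ha : ∀ l' ∈ C, l' ≠ l.neg → l'.neg ∈ t'.lits) :
      Step M φ eager (.analyze ((l, r) :: t) db C) 1 (.search t' (insert C db))
  /-- restart: undo all decisions -/
  | restart (t' p : Trail V) (db : Finset (Clause V)) (d : Lit V)
      (h0 : ∀ e ∈ t', e.2 ≠ none) :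
      Step M φ eager (.search (p ++ (d, none) :: t') db) 1 (.search t' db)
  /-- the empty clause has been derived -/
  | fail (t : Trail V) (db : Finset (Clause V)) :
      Step M φ eager (.analyze t db ∅) 1 .unsat

/-- Finite runs of the solver with their total costs. -/
inductive Run {V : Type*} [DecidableEq V] (M : XorModule) (φ : CnfXor V) (eager : Bool) :
    State V → ℕ → State V → Prop
  | refl (σ : State V) : Run M φ eager σ 0 σ
  | step (σ τ ρ : State V) (k s : ℕ) (h : Step M φ eager σ k τ) (hr : Run M φ eager τ s ρ) :
      Run M φ eager σ (k + s) ρ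

/-- The proof system underlying the solver: a refutation of `φ` of size `s` is a run of
total cost `s` from the initial state to the answer "unsatisfiable". -/
def DpllXorRefutes {V : Type*} [DecidableEq V] (M : XorModule) (eager : Bool) (φ : CnfXor V)
    (s : ℕ) : Prop :=
  Run M φ eager (.search [] φ.clauses) s .unsat

end DpllXor

/-!
The proof rests on two simulations, both of which use that the rules of Subst and EC never widen
an xor-constraint (`XorModule.Rule.card_le`), so that every constraint in sight has boundedly many
variables.

*From the solver to resolution.* A constraint of bounded width is encoded by boundedly many
clauses, and a sound inference from two such constraints is simulated by boundedly many resolution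
steps (`Covers.combine`); an EC inference along a path is split into its links
(`EqvPath.exists_covers`). All of this works relative to the negations of the literals `L` of an
explanation: following the derivation vertex by vertex, resolution derives the block of clauses
of `L ⇒ D` for each label `D` whose explanation is part of `L` (`XorDerivation.exists_covers`), and
so a clause contained in the reported one. As conflict analysis consists of resolution steps, and
since resolving subclauses of two clauses gives a subclause of their resolvent or is unnecessary,
resolution keeps a subclause of every clause that the solver holds (`Step.exists_extends`).

*From resolution to the solver.* The solver decides only when propagation is complete, so that
the run is one of the eager and of the non-eager solver. A clause is absorbed
(`Absorbed`) by the database if propagation, by unit propagation and the xor module together, exploits it as if it were in the database. The clauses of `φ` and of the translations of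
its xor-constraints are absorbed from the start. If two clauses are absorbed, then falsifying their
resolvent `C` leads propagation to a conflict. As long as some `l ∈ C` is not inferred from the
falsity of the rest of `C`, the solver decides the negations of the other literals and then that
of `l`, runs into a conflict and learns the clause obtained by conflict analysis back to its last
decision. From then on `l` is inferred (`Ready.reaches_propagates`); so learning at most one clause
for each literal makes `C` absorbed. When the empty clause is absorbed, propagation without any
decision gives a conflict and the solver stops.

An eager solver has to complete propagation before it decides, and the derivations it uses for
that purpose count. They are small: there are only polynomially many constraints of bounded
width, a derivation need not repeat a label, and a path of binary constraints may be shortened to a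
path in the graph of pairs of a variable and a parity (`EqvPath.exists_short`). Hence whatever can
be reported can be reported at polynomial cost (`exists_reports_of_xorImplies`).
-/

namespace DpllXor

/-! ### Literals, parity and the rules of the xor modules -/

section Basics

variable {V : Type*}

@[simp] theorem Lit.var_neg (l : Lit V) : l.neg.var = l.var := rfl

@[simp] theorem Lit.sign_neg (l : Lit V) : l.neg.sign = !l.sign := rfl

@[simp] theorem Lit.neg_neg (l : Lit V) : l.neg.neg = l := by
  ext <;> simp

theorem Lit.neg_injective : Function.Injective (Lit.neg : Lit V → Lit V) :=
  Function.Involutive.injective Lit.neg_neg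

theorem Lit.neg_ne (l : Lit V) : l.neg ≠ l := fun h => by
  simpa using congrArg Lit.sign h

theorem Lit.eq_or_eq_neg {l m : Lit V} (h : l.var = m.var) : l = m ∨ l = m.neg := by
  by_cases hs : l.sign = m.sign
  · exact Or.inl (Lit.ext h hs)
  · exact Or.inr (Lit.ext h (by cases hl : l.sign <;> cases hm : m.sign <;> simp_all))

theorem Lit.toXor_injective : Function.Injective (Lit.toXor : Lit V → XorConstraint V) := by
  intro l m h
  have h1 := congrArg XorConstraint.vars h
  have h2 := congrArg XorConstraint.parity h
  exact Lit.ext (by simpa [Lit.toXor] using h1) h2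

theorem Lit.toXor_ne_bot (l : Lit V) : l.toXor ≠ XorConstraint.bot V := fun h => by
  simpa [Lit.toXor, XorConstraint.bot] using congrArg XorConstraint.vars h

/-- The truth value `a` as an element of `ZMod 2`. -/
def bit (a : Bool) : ZMod 2 := if a then 1 else 0

theorem bit_xor : ∀ a b : Bool, bit (xor a b) = bit a + bit b := by decide

theorem bit_inj : ∀ {a b : Bool}, bit a = bit b ↔ a = b := by decide

/-- The assignment `σ` satisfies the xor-constraint `D`. -/
def XorConstraint.Holds (D : XorConstraint V) (σ : V → Bool) : Prop :=
  ∑ x ∈ D.vars, bit (σ x) = bit D.parity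

theorem XorConstraint.Holds.congr {D : XorConstraint V} {σ τ : V → Bool}
    (h : ∀ x ∈ D.vars, σ x = τ x) : D.Holds σ ↔ D.Holds τ := by
  unfold XorConstraint.Holds
  rw [Finset.sum_congr rfl fun x hx => by rw [h x hx]]

theorem Lit.toXor_holds {l : Lit V} {σ : V → Bool} : l.toXor.Holds σ ↔ σ l.var = l.sign := by
  simp [XorConstraint.Holds, Lit.toXor, bit_inj]

variable [DecidableEq V]

theorem sum_symmDiff_of_charTwo (A B : Finset V) (f : V → ZMod 2) :
    ∑ x ∈ symmDiff A B, f x = ∑ x ∈ A, f x + ∑ x ∈ B, f x := by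
  have hd : Disjoint (A \ B) (B \ A) := disjoint_sdiff_sdiff
  have hs : symmDiff A B = (A \ B) ∪ (B \ A) := rfl
  rw [hs, Finset.sum_union hd, ← Finset.sum_inter_add_sum_sdiff A B,
    ← Finset.sum_inter_add_sum_sdiff B A, Finset.inter_comm B A]
  linear_combination (-1 : ZMod 2) * CharTwo.add_self_eq_zero (∑ x ∈ A ∩ B, f x)

theorem XorConstraint.Holds.subst {D : XorConstraint V} {σ : V → Bool} (h : D.Holds σ) {x : V}
    {Y : Finset V} {q : Bool} (hx : bit (σ x) = ∑ y ∈ Y, bit (σ y) + bit q) :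
    (D.subst x Y q).Holds σ := by
  unfold XorConstraint.subst
  split_ifs with hD
  · unfold XorConstraint.Holds at h ⊢
    rw [← Finset.add_sum_erase _ _ hD] at h
    rw [sum_symmDiff_of_charTwo, bit_xor, ← h, hx]
    linear_combination (-1 : ZMod 2) * CharTwo.add_self_eq_zero (bit q)
  · exact h

/-- The clauses of `D.cnf` are the clauses over the variables of `D` that are falsified by an
assignment violating `D`. -/
theorem XorConstraint.mem_cnf_iff {D : XorConstraint V} {C : Clause V} :
    C ∈ D.cnf ↔ ∃ τ : V → Bool, ¬ D.Holds τ ∧ C = D.vars.image fun x => ⟨x, !τ x⟩ := by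
  have key : ∀ S ⊆ D.vars, (decide (Odd S.card) ≠ D.parity ↔
      ¬ D.Holds fun x => decide (x ∈ S)) := by
    intro S hS
    have h1 : ∑ x ∈ D.vars, bit (decide (x ∈ S)) = (S.card : ZMod 2) := by
      simp [bit, Finset.inter_eq_right.2 hS]
    have h2 : (S.card : ZMod 2) = bit (decide (Odd S.card)) := by
      by_cases ho : Odd S.card
      · simp [bit, ho, ZMod.natCast_eq_one_iff_odd.2 ho]
      · simp [bit, ho, ZMod.natCast_eq_zero_iff_even.2 (Nat.not_odd_iff_even.1 ho)]
    rw [XorConstraint.Holds, h1, h2, bit_inj]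
  simp only [XorConstraint.cnf, Finset.mem_image, Finset.mem_filter, Finset.mem_powerset]
  constructor
  · rintro ⟨S, ⟨hS, hp⟩, rfl⟩
    exact ⟨_, (key S hS).1 hp, by simp⟩
  · rintro ⟨τ, hτ, rfl⟩
    refine ⟨D.vars.filter (τ · = true), ⟨Finset.filter_subset _ _, ?_⟩, ?_⟩
    · rw [key _ (Finset.filter_subset _ _)]
      rwa [XorConstraint.Holds.congr (τ := τ)]
      intro x hx
      simp [hx]
    · refine Finset.image_congr fun x hx => ?_
      have hx : x ∈ D.vars := hx
      simp [hx]

theorem XorConstraint.card_cnf_le (D : XorConstraint V) : D.cnf.card ≤ 2 ^ D.vars.card := by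
  refine Finset.card_image_le.trans ((Finset.card_filter_le _ _).trans ?_)
  rw [Finset.card_powerset]

theorem XorConstraint.subst_empty {D : XorConstraint V} {x : V} (hx : x ∈ D.vars) (q : Bool) :
    D.subst x ∅ q = ⟨D.vars.erase x, xor D.parity q⟩ := by
  rw [XorConstraint.subst, if_pos hx, ← Finset.bot_eq_empty, symmDiff_bot]

theorem XorConstraint.vars_subst_singleton_subset (D : XorConstraint V) (x y : V) (q : Bool) :
    (D.subst x {y} q).vars ⊆ insert y D.vars := by
  unfold XorConstraint.subst
  split_ifs with hD
  · intro z
    simp only [Finset.mem_symmDiff, Finset.mem_erase, Finset.mem_singleton, Finset.mem_insert]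
    tauto
  · exact Finset.subset_insert _ _

theorem XorConstraint.card_vars_subst_singleton_le {D : XorConstraint V} {x : V} (hx : x ∈ D.vars)
    (y : V) (q : Bool) : (D.subst x {y} q).vars.card ≤ D.vars.card := by
  rw [XorConstraint.subst, if_pos hx]
  have h1 : symmDiff (D.vars.erase x) {y} ⊆ insert y (D.vars.erase x) := by
    intro z
    simp only [Finset.mem_symmDiff, Finset.mem_erase, Finset.mem_singleton, Finset.mem_insert]
    tauto
  have h2 := Finset.card_le_card h1
  have h3 := Finset.card_insert_le y (D.vars.erase x)
  have h4 := Finset.card_erase_add_one hx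
  simp only at *
  omega

/-- No rule of either module increases the width of xor-constraints. Hence all labels of a
derivation have bounded width, and bounded blocks of clauses encode them. -/
theorem XorModule.Rule.card_le {M : XorModule} {P : List (XorConstraint V)} {D : XorConstraint V}
    (h : M.Rule P D) {b : ℕ} (hP : ∀ E ∈ P, E.vars.card ≤ b) : D.vars.card ≤ b := by
  cases M with
  | subst =>
    cases h with
    | unitPos x D hx | unitNeg x D hx =>
      rw [XorConstraint.subst_empty hx]
      exact Finset.card_erase_le.trans (hP D (by simp))
    | eqvPos x y D hxy hx | eqvNeg x y D hxy hx =>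
      exact (XorConstraint.card_vars_subst_singleton_le hx _ _).trans (hP D (by simp))
  | ec =>
    cases h with
    | unit x p D hx =>
      rw [XorConstraint.subst_empty hx]
      exact Finset.card_erase_le.trans (hP D (by simp))
    | path x y p L D hL hxy hx hy =>
      exact (XorConstraint.card_vars_subst_singleton_le hx _ _).trans (hP D (by simp))

theorem XorModule.Rule.vars_subset {M : XorModule} {P : List (XorConstraint V)}
    {D : XorConstraint V} (h : M.Rule P D) {Z : Finset V} (hP : ∀ E ∈ P, E.vars ⊆ Z) :
    D.vars ⊆ Z := by
  cases M with
  | subst =>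
    cases h with
    | unitPos x D hx | unitNeg x D hx =>
      rw [XorConstraint.subst_empty hx]
      exact (Finset.erase_subset _ _).trans (hP D (by simp))
    | eqvPos x y D hxy hx | eqvNeg x y D hxy hx =>
      refine (XorConstraint.vars_subst_singleton_subset _ _ _ _).trans
        (Finset.insert_subset ?_ (hP D (by simp)))
      exact hP _ List.mem_cons_self (by simp)
  | ec =>
    cases h with
    | unit x p D hx =>
      rw [XorConstraint.subst_empty hx]
      exact (Finset.erase_subset _ _).trans (hP D (by simp))
    | path x y p L D hL hxy hx hy =>
      refine (XorConstraint.vars_subst_singleton_subset _ _ _ _).trans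
        (Finset.insert_subset ?_ (hP D (by simp)))
      exact hP D (by simp) hy

theorem XorModule.Rule.ne_nil {M : XorModule} {P : List (XorConstraint V)}
    {D : XorConstraint V} (h : M.Rule P D) : P ≠ [] := by
  cases M <;> cases h <;> simp

namespace XorDerivation

variable {M : XorModule} {ψ : Finset (XorConstraint V)}

theorem mem_expl_of_not_isInput (G : XorDerivation M ψ) {φxor : Finset (XorConstraint V)}
    {Va : Set (Fin G.n)} {v : Fin G.n} (hv : ¬ G.IsInput v) (ha : v ∉ Va) {D : XorConstraint V} :
    D ∈ G.expl φxor Va v ↔ ∃ u ∈ G.prem v, D ∈ G.expl φxor Va ⟨u, u.2.trans v.2⟩ := by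
  rw [XorDerivation.expl, if_neg hv, if_neg ha]
  induction G.prem v with
  | nil => simp
  | cons u P ih => simp [ih]

theorem expl_of_isInput (G : XorDerivation M ψ) {φxor : Finset (XorConstraint V)}
    {Va : Set (Fin G.n)} {v : Fin G.n} (hv : G.IsInput v) :
    G.expl φxor Va v = if G.label v ∈ φxor then ∅ else {G.label v} := by
  rw [XorDerivation.expl, if_pos hv]

theorem expl_of_mem (G : XorDerivation M ψ) {φxor : Finset (XorConstraint V)}
    {Va : Set (Fin G.n)} {v : Fin G.n} (hv : ¬ G.IsInput v) (ha : v ∈ Va) :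
    G.expl φxor Va v = {G.label v} := by
  rw [XorDerivation.expl, if_neg hv, if_pos ha]

theorem label_mem_of_isInput (G : XorDerivation M ψ) {v : Fin G.n} (hv : G.IsInput v) :
    G.label v ∈ ψ :=
  (G.valid v).elim And.right fun h => absurd hv h.1

theorem rule_of_not_isInput (G : XorDerivation M ψ) {v : Fin G.n} (hv : ¬ G.IsInput v) :
    M.Rule ((G.prem v).map fun u : Fin v => G.label ⟨u, u.2.trans v.2⟩) (G.label v) :=
  (G.valid v).elim (fun h => absurd h.1 hv) And.right

theorem card_vars_label_le (G : XorDerivation M ψ) {b : ℕ} (hψ : ∀ D ∈ ψ, D.vars.card ≤ b)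
    (v : Fin G.n) : (G.label v).vars.card ≤ b := by
  induction hv : v.val using Nat.strong_induction_on generalizing v with
  | _ m ih =>
    by_cases hi : G.IsInput v
    · exact hψ _ (G.label_mem_of_isInput hi)
    · refine (G.rule_of_not_isInput hi).card_le fun E hE => ?_
      obtain ⟨u, -, rfl⟩ := List.mem_map.1 hE
      exact ih u (hv ▸ u.2) ⟨u, u.2.trans v.2⟩ rfl

end XorDerivation

end Basics

/-! ### Constraints encoded by clauses, relative to a conjunction of literals -/

section Covers

variable {V : Type*}

/-- The assignment `σ` satisfies all literals in `L`. -/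
def Models (σ : V → Bool) (L : Finset (Lit V)) : Prop := ∀ m ∈ L, σ m.var = m.sign

/-- The clause `C` has variables in `X` or in `L` only, and it is false under `σ`. For an
assignment satisfying `L` this says that `C` is part of the disjunction of `¬ L` with the clause
over `X` falsified by `σ`. -/
def Refutes (C : Clause V) (L : Finset (Lit V)) (X : Finset V) (σ : V → Bool) : Prop :=
  ∀ l ∈ C, σ l.var ≠ l.sign ∧ (l.var ∈ X ∨ ∃ m ∈ L, m.var = l.var)

/-- The clauses in `π` encode `L ⇒ P`, where `P` is a constraint on the variables `X`: every
assignment that satisfies `L` and violates `P` is refuted by some clause of `π`. -/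
def Covers (π : List (Clause V)) (L : Finset (Lit V)) (X : Finset V) (P : (V → Bool) → Prop) :
    Prop :=
  ∀ σ, Models σ L → ¬ P σ → ∃ C ∈ π, Refutes C L X σ

theorem Covers.mono {π π' : List (Clause V)} {L : Finset (Lit V)} {X : Finset V}
    {P : (V → Bool) → Prop} (h : Covers π L X P) (hπ : π ⊆ π') :
    Covers π' L X P := fun σ hσ hP =>
  let ⟨C, hC, hr⟩ := h σ hσ hP
  ⟨C, hπ hC, hr⟩

/-- The clauses in `π` encode `L ⇒ D`. -/
abbrev CoversXor (π : List (Clause V)) (L : Finset (Lit V)) (D : XorConstraint V) : Prop :=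
  Covers π L D.vars D.Holds

theorem XorConstraint.holds_singleton {x : V} {p : Bool} {σ : V → Bool} :
    (⟨{x}, p⟩ : XorConstraint V).Holds σ ↔ bit (σ x) = bit p := by
  simp [XorConstraint.Holds]

theorem coversXor_of_mem {π : List (Clause V)} {L : Finset (Lit V)} {l : Lit V} (h : l ∈ L) :
    CoversXor π L l.toXor := fun _ hσ hD =>
  absurd (Lit.toXor_holds.2 (hσ l h)) hD

/-- The set of literals does not contain a literal together with its negation. -/
def Consistent (T : Set (Lit V)) : Prop := ∀ l ∈ T, l.neg ∉ T

theorem Consistent.exists_assignment {T : Set (Lit V)} (hT : Consistent T) :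
    ∃ σ : V → Bool, ∀ l ∈ T, σ l.var = l.sign := by
  classical
  refine ⟨fun x => decide (⟨x, true⟩ ∈ T), fun l hl => ?_⟩
  have := hT l hl
  obtain ⟨x, s⟩ := l
  cases s
  · simpa [Lit.neg] using this
  · simpa using hl

end Covers

/-! ### Resolution derivations and their extensions -/

section Resolution

variable {V : Type*} [DecidableEq V]

/-- `π'` is a resolution derivation on `F` that contains all clauses of `π` and is longer than `π`
by at most `s`. -/
structure Extends (F : Finset (Clause V)) (π π' : List (Clause V)) (s : ℕ) : Prop where
  der : IsResolutionDerivation F π'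
  subset : π ⊆ π'
  length_le : π'.length ≤ π.length + s

variable {F : Finset (Clause V)} {π π' π'' : List (Clause V)} {s s' : ℕ} {L : Finset (Lit V)}

theorem Extends.refl (h : IsResolutionDerivation F π) (s : ℕ) : Extends F π π s :=
  ⟨h, fun _ h => h, Nat.le_add_right _ _⟩

theorem Extends.trans (h : Extends F π π' s) (h' : Extends F π' π'' s') :
    Extends F π π'' (s + s') :=
  ⟨h'.der, fun _ hC => h'.subset (h.subset hC), by
    have := h.length_le; have := h'.length_le; omega⟩

theorem Extends.mono (h : Extends F π π' s) (hs : s ≤ s') : Extends F π π' s' :=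
  ⟨h.der, h.subset, h.length_le.trans (Nat.add_le_add_left hs _)⟩

theorem isResolutionDerivation_toList (F : Finset (Clause V)) :
    IsResolutionDerivation F F.toList := fun _ _ =>
  Or.inl (Finset.mem_toList.1 (List.getElem_mem _))

theorem IsResolutionDerivation.append_resolvent (h : IsResolutionDerivation F π) {A B : Clause V}
    {x : V} (hA : A ∈ π) (hB : B ∈ π) (hxA : (⟨x, true⟩ : Lit V) ∈ A)
    (hxB : (⟨x, false⟩ : Lit V) ∈ B) :
    Extends F π (π ++ [resolvent A B ⟨x, true⟩]) 1 := by
  refine ⟨fun i hi => ?_, List.subset_append_left _ _, by simp⟩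
  by_cases hip : i < π.length
  · rw [List.getElem_append_left hip]
    refine (h i hip).imp_right ?_
    rintro ⟨j, k, hj, hk, x, h1, h2, h3⟩
    refine ⟨j, k, hj, hk, x, ?_⟩
    rw [List.getElem_append_left (hj.trans hip), List.getElem_append_left (hk.trans hip)]
    exact ⟨h1, h2, h3⟩
  · obtain ⟨j, hj, rfl⟩ := List.getElem_of_mem hA
    obtain ⟨k, hk, rfl⟩ := List.getElem_of_mem hB
    have hi' : i = π.length := by simp at hi; omega
    subst hi'
    refine Or.inr ⟨j, k, hj, hk, x, ?_⟩
    rw [List.getElem_append_left hj, List.getElem_append_left hk]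
    exact ⟨hxA, hxB, by simp⟩

/-- Resolution without weakening: when one of the premises does not contain the literal resolved
on, it already subsumes the resolvent. -/
theorem IsResolutionDerivation.exists_subset_resolvent (h : IsResolutionDerivation F π)
    {A B A' B' : Clause V} {l : Lit V} (hA' : A' ∈ π) (hB' : B' ∈ π) (hA : A' ⊆ A) (hB : B' ⊆ B) :
    ∃ π', Extends F π π' 1 ∧ ∃ C ∈ π', C ⊆ resolvent A B l := by
  by_cases hlA : l ∈ A'
  · by_cases hlB : l.neg ∈ B'
    · have key : resolvent A' B' l ⊆ resolvent A B l :=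
        Finset.union_subset_union (Finset.erase_subset_erase _ hA) (Finset.erase_subset_erase _ hB)
      obtain ⟨x, b⟩ := l
      cases b
      · refine ⟨_, h.append_resolvent hB' hA' hlB hlA, _,
          List.mem_append_right _ (List.mem_singleton_self _), ?_⟩
        refine Finset.Subset.trans ?_ key
        exact (Finset.union_comm _ _).subset
      · exact ⟨_, h.append_resolvent hA' hB' hlA hlB, _,
          List.mem_append_right _ (List.mem_singleton_self _), key⟩
    · refine ⟨π, Extends.refl h 1, B', hB', fun m hm => Finset.mem_union_right _ ?_⟩
      exact Finset.mem_erase.2 ⟨fun h => hlB (h ▸ hm), hB hm⟩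
  · refine ⟨π, Extends.refl h 1, A', hA', fun m hm => Finset.mem_union_left _ ?_⟩
    exact Finset.mem_erase.2 ⟨fun h => hlA (h ▸ hm), hA hm⟩

/-- Resolving away the variables in `Y`. -/
theorem exists_refutes_of_forall (L : Finset (Lit V)) (Y : Finset V) :
    ∀ (Z : Finset V) (σ : V → Bool) (π : List (Clause V)), IsResolutionDerivation F π →
      Models σ L →
      (∀ τ, Models τ L → (∀ x ∉ Y, τ x = σ x) → ∃ C ∈ π, Refutes C L (Z ∪ Y) τ) →
      ∃ π', Extends F π π' (2 ^ Y.card - 1) ∧ ∃ C ∈ π', Refutes C L Z σ := by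
  induction Y using Finset.induction_on with
  | empty =>
    intro Z σ π hπ hσ h
    obtain ⟨C, hC, hr⟩ := h σ hσ fun _ _ => rfl
    exact ⟨π, Extends.refl hπ _, C, hC, by simpa using hr⟩
  | insert y Y hy ih =>
    intro Z σ π hπ hσ h
    have hcard : 2 ^ (insert y Y).card - 1 = (2 ^ Y.card - 1) + (2 ^ Y.card - 1) + 1 := by
      have := Nat.one_le_two_pow (n := Y.card)
      rw [Finset.card_insert_of_notMem hy, pow_succ]
      omega
    have hZ : insert y Z ∪ Y = Z ∪ insert y Y := by
      rw [Finset.insert_union, Finset.union_insert]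
    by_cases hyL : ∃ m ∈ L, m.var = y
    · -- the value of `y` is fixed by `L`, and literals over `y` may stay in the clause
      obtain ⟨π', he, C, hC, hr⟩ := ih (insert y Z) σ π hπ hσ fun τ hτ hag => by
        rw [hZ]
        exact h τ hτ fun x hx => hag x fun hxY => hx (Finset.mem_insert_of_mem hxY)
      refine ⟨π', he.mono (by omega), C, hC, fun l hl => ⟨(hr l hl).1, ?_⟩⟩
      rcases (hr l hl).2 with h1 | h1
      · rcases Finset.mem_insert.1 h1 with h2 | h2
        · exact Or.inr (h2 ▸ hyL)
        · exact Or.inl h2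
      · exact Or.inr h1
    · have hM : ∀ b, Models (Function.update σ y b) L := fun b m hm => by
        rw [Function.update_of_ne fun h => hyL ⟨m, hm, h⟩]
        exact hσ m hm
      have hH : ∀ b τ, Models τ L → (∀ x ∉ Y, τ x = Function.update σ y b x) →
          ∃ C ∈ π, Refutes C L (insert y Z ∪ Y) τ := fun b τ hτ hag => by
        rw [hZ]
        refine h τ hτ fun x hx => ?_
        rw [Finset.mem_insert, not_or] at hx
        rw [hag x hx.2, Function.update_of_ne hx.1]
      obtain ⟨π₁, he₁, C₁, hC₁, hr₁⟩ := ih (insert y Z) _ π hπ (hM false) (hH false)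
      obtain ⟨π₂, he₂, C₂, hC₂, hr₂⟩ := ih (insert y Z) _ π₁ he₁.der (hM true) fun τ hτ hag => by
        obtain ⟨C, hC, hr⟩ := hH true τ hτ hag
        exact ⟨C, he₁.subset hC, hr⟩
      obtain ⟨π₃, he₃, C, hC, hsub⟩ := he₂.der.exists_subset_resolvent (l := ⟨y, true⟩)
        (he₂.subset hC₁) hC₂ subset_rfl subset_rfl
      have hr : ∀ b C, Refutes C L (insert y Z) (Function.update σ y b) → ∀ l ∈ C.erase ⟨y, !b⟩,
          σ l.var ≠ l.sign ∧ (l.var ∈ Z ∨ ∃ m ∈ L, m.var = l.var) := fun b C hr l hl => by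
        obtain ⟨hne, hl⟩ := Finset.mem_erase.1 hl
        obtain ⟨h1, h2⟩ := hr l hl
        have hly : l.var ≠ y := fun hly => hne <| Lit.ext hly <| by
          rw [hly, Function.update_self] at h1
          cases b <;> cases hs : l.sign <;> simp_all
        rw [Function.update_of_ne hly] at h1
        refine ⟨h1, h2.imp_left fun h2 => ?_⟩
        exact (Finset.mem_insert.1 h2).resolve_left hly
      refine ⟨π₃, ((he₁.trans he₂).trans he₃).mono hcard.ge, C, hC, fun l hl => ?_⟩
      rcases Finset.mem_union.1 (hsub hl) with h1 | h1
      · exact hr false C₁ hr₁ l h1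
      · exact hr true C₂ hr₂ l h1

/-- If the clauses of `π` over `X ∪ Y` encode the constraint `P` on `X`, then resolution derives an
encoding over `X`, one clause for each of the `2 ^ X.card` assignments of `X`. -/
theorem Covers.eliminate {X Y : Finset V} {P : (V → Bool) → Prop} (hπ : IsResolutionDerivation F π)
    (hXY : Disjoint X Y) (hP : ∀ σ τ : V → Bool, (∀ x ∈ X, σ x = τ x) → P σ → P τ)
    (h : Covers π L (X ∪ Y) P) :
    ∃ π', Extends F π π' (2 ^ X.card * 2 ^ Y.card) ∧ Covers π' L X P := by
  classical
  have key : ∀ 𝒮 : Finset (Finset V), ∃ π', Extends F π π' (𝒮.card * 2 ^ Y.card) ∧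
      ∀ σ, Models σ L → ¬ P σ → X.filter (σ · = true) ∈ 𝒮 → ∃ C ∈ π', Refutes C L X σ := by
    intro 𝒮
    induction 𝒮 using Finset.induction_on with
    | empty => exact ⟨π, Extends.refl hπ _, by simp⟩
    | insert S 𝒮 hS ih =>
      obtain ⟨π₁, he₁, h₁⟩ := ih
      by_cases hσ : ∃ σ, Models σ L ∧ ¬ P σ ∧ X.filter (σ · = true) = S
      · obtain ⟨σ, hM, hPσ, hσS⟩ := hσ
        obtain ⟨π₂, he₂, C, hC, hr⟩ := exists_refutes_of_forall L Y X σ π₁ he₁.der hM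
          fun τ hτ hag => by
            obtain ⟨C, hC, hr⟩ := h τ hτ fun hPτ => hPσ <| hP τ σ
              (fun x hx => hag x fun hxY => Finset.disjoint_left.1 hXY hx hxY) hPτ
            exact ⟨C, he₁.subset hC, hr⟩
        refine ⟨π₂, (he₁.trans he₂).mono ?_, fun τ hτ hPτ hτS => ?_⟩
        · rw [Finset.card_insert_of_notMem hS, Nat.succ_mul]
          exact Nat.add_le_add_left (Nat.sub_le _ _) _
        · rcases Finset.mem_insert.1 hτS with h2 | h2
          · -- `σ` and `τ` agree on the variables of `C`
            refine ⟨C, hC, fun l hl => ⟨?_, (hr l hl).2⟩⟩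
            have h3 := (hr l hl).1
            rcases (hr l hl).2 with h4 | ⟨m, hm, hml⟩
            · have h5 : σ l.var = true ↔ τ l.var = true := by
                have := congrArg (l.var ∈ ·) (hσS.trans h2.symm)
                simpa [h4] using this
              rwa [← Bool.eq_iff_iff.2 h5]
            · rw [← hml, hτ m hm]
              rwa [← hml, hM m hm] at h3
          · obtain ⟨C, hC, hr⟩ := h₁ τ hτ hPτ h2
            exact ⟨C, he₂.subset hC, hr⟩
      · push Not at hσ
        refine ⟨π₁, he₁.mono (Nat.mul_le_mul_right _
          (Finset.card_le_card (Finset.subset_insert _ _))), fun τ hτ hPτ hτS => ?_⟩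
        rcases Finset.mem_insert.1 hτS with h2 | h2
        · exact absurd h2 (hσ τ hτ hPτ)
        · exact h₁ τ hτ hPτ h2
  obtain ⟨π', he, h'⟩ := key X.powerset
  rw [Finset.card_powerset] at he
  exact ⟨π', he, fun σ hσ hPσ => h' σ hσ hPσ (Finset.mem_powerset.2 (Finset.filter_subset _ _))⟩

/-- Every sound inference from two constraints on boundedly many variables is simulated by a
bounded number of resolution steps. -/
theorem Covers.combine {X₁ X₂ X₃ : Finset V} {P₁ P₂ P₃ : (V → Bool) → Prop} {b : ℕ}
    (hπ : IsResolutionDerivation F π) (h₁ : Covers π L X₁ P₁) (h₂ : Covers π L X₂ P₂)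
    (hP : ∀ σ, P₁ σ → P₂ σ → P₃ σ)
    (hP₃ : ∀ σ τ : V → Bool, (∀ x ∈ X₃, σ x = τ x) → P₃ σ → P₃ τ)
    (hb₁ : X₁.card ≤ b) (hb₂ : X₂.card ≤ b) (hb₃ : X₃.card ≤ b) :
    ∃ π', Extends F π π' (2 ^ (3 * b)) ∧ Covers π' L X₃ P₃ := by
  have hc : Covers π L (X₃ ∪ (X₁ ∪ X₂) \ X₃) P₃ := fun σ hσ hPσ => by
    by_cases hP₁ : P₁ σ
    · obtain ⟨C, hC, hr⟩ := h₂ σ hσ fun hP₂ => hPσ (hP σ hP₁ hP₂)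
      refine ⟨C, hC, fun l hl => ⟨(hr l hl).1, (hr l hl).2.imp_left fun h => ?_⟩⟩
      simp [h]
    · obtain ⟨C, hC, hr⟩ := h₁ σ hσ hP₁
      refine ⟨C, hC, fun l hl => ⟨(hr l hl).1, (hr l hl).2.imp_left fun h => ?_⟩⟩
      simp [h]
  obtain ⟨π', he, h'⟩ := hc.eliminate hπ Finset.disjoint_sdiff hP₃
  refine ⟨π', he.mono ?_, h'⟩
  rw [← pow_add]
  refine Nat.pow_le_pow_right (by norm_num) ?_
  have h1 : ((X₁ ∪ X₂) \ X₃).card ≤ (X₁ ∪ X₂).card := Finset.card_le_card Finset.sdiff_subset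
  have h2 := Finset.card_union_le X₁ X₂
  omega

/-! ### Explanations have short resolution proofs -/

theorem XorConstraint.holds_pair {x y : V} {p : Bool} {σ : V → Bool} (h : x ≠ y) :
    (⟨{x, y}, p⟩ : XorConstraint V).Holds σ ↔ bit (σ x) = bit (σ y) + bit p := by
  rw [XorConstraint.Holds, Finset.sum_pair h]
  exact (by decide : ∀ a c p : Bool, bit a + bit c = bit p ↔ bit a = bit c + bit p) _ _ _

theorem CoversXor.combine {D₁ D₂ D₃ : XorConstraint V} {b : ℕ}
    (hπ : IsResolutionDerivation F π) (h₁ : CoversXor π L D₁) (h₂ : CoversXor π L D₂)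
    (hP : ∀ σ, D₁.Holds σ → D₂.Holds σ → D₃.Holds σ)
    (hb₁ : D₁.vars.card ≤ b) (hb₂ : D₂.vars.card ≤ b) (hb₃ : D₃.vars.card ≤ b) :
    ∃ π', Extends F π π' (2 ^ (3 * b)) ∧ CoversXor π' L D₃ :=
  Covers.combine hπ h₁ h₂ hP (fun _ _ h => (XorConstraint.Holds.congr h).1) hb₁ hb₂ hb₃

/-- Along a path of binary constraints resolution derives `x ⊕ y ≡ p` link by link, so that only
three variables are involved at a time. -/
theorem EqvPath.exists_covers {x y : V} {p : Bool} {K : List (XorConstraint V)}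
    (h : EqvPath x y p K) {b : ℕ} (hb : 2 ≤ b) :
    ∀ π : List (Clause V), IsResolutionDerivation F π → (∀ E ∈ K, CoversXor π L E) →
      ∃ π', Extends F π π' (2 ^ (3 * b) * K.length) ∧
        Covers π' L {x, y} fun σ => bit (σ x) = bit (σ y) + bit p := by
  induction h with
  | single x y p hxy =>
    intro π hπ hK
    refine ⟨π, Extends.refl hπ _, fun σ hσ hP =>
      hK _ List.mem_cons_self σ hσ ?_⟩
    rwa [XorConstraint.holds_pair hxy]
  | cons x y z p q K hxy h ih =>
    intro π hπ hK
    obtain ⟨π₁, he₁, h₁⟩ := ih π hπ fun E hE => hK E (List.mem_cons_of_mem _ hE)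
    obtain ⟨π₂, he₂, h₂⟩ := Covers.combine (b := b) (X₃ := {x, z})
      (P₃ := fun σ => bit (σ x) = bit (σ z) + bit (xor p q)) he₁.der
      ((hK _ List.mem_cons_self).mono he₁.subset) h₁
      (fun σ h1 h2 => by
        rw [XorConstraint.holds_pair hxy] at h1
        rw [h1, h2, bit_xor]
        ring)
      (fun σ τ hστ h => by rwa [← hστ x (by simp), ← hστ z (by simp)])
      (Finset.card_le_two.trans hb) (Finset.card_le_two.trans hb) (Finset.card_le_two.trans hb)
    refine ⟨π₂, (he₁.trans he₂).mono ?_, h₂⟩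
    rw [List.length_cons, Nat.mul_succ]

/-- Each application of a rule costs a number of resolution steps linear in the number of its
premises. -/
theorem XorModule.Rule.exists_covers {M : XorModule} {P : List (XorConstraint V)}
    {D : XorConstraint V} (h : M.Rule P D) {b : ℕ} (hb : 2 ≤ b) (hP : ∀ E ∈ P, E.vars.card ≤ b)
    (hπ : IsResolutionDerivation F π) (hc : ∀ E ∈ P, CoversXor π L E) :
    ∃ π', Extends F π π' (2 ^ (3 * b) * P.length) ∧ CoversXor π' L D := by
  have hD := h.card_le hP
  have two : ∀ (D₁ D₂ : XorConstraint V), P = [D₁, D₂] →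
      (∀ σ, D₁.Holds σ → D₂.Holds σ → D.Holds σ) →
      ∃ π', Extends F π π' (2 ^ (3 * b) * P.length) ∧ CoversXor π' L D := by
    rintro D₁ D₂ rfl hsound
    obtain ⟨π', he, h'⟩ := CoversXor.combine hπ (hc D₁ (by simp)) (hc D₂ (by simp)) hsound
      (hP D₁ (by simp)) (hP D₂ (by simp)) hD
    exact ⟨π', he.mono (Nat.le_mul_of_pos_right _ (by simp)), h'⟩
  cases M with
  | subst =>
    cases h with
    | unitPos x D hx | unitNeg x D hx =>
      refine two _ _ rfl fun σ h1 h2 => h2.subst ?_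
      rw [XorConstraint.holds_singleton] at h1
      rw [h1, Finset.sum_empty, zero_add]
    | eqvPos x y D hxy hx | eqvNeg x y D hxy hx =>
      refine two _ _ rfl fun σ h1 h2 => h2.subst ?_
      rw [XorConstraint.holds_pair hxy] at h1
      rw [h1, Finset.sum_singleton]
  | ec =>
    cases h with
    | unit x p D hx =>
      refine two _ _ rfl fun σ h1 h2 => h2.subst ?_
      rw [XorConstraint.holds_singleton] at h1
      rw [h1, Finset.sum_empty, zero_add]
    | path x y p K D hK hxy hx hy =>
      obtain ⟨π₁, he₁, h₁⟩ := hK.exists_covers hb π hπ fun E hE =>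
        hc E (List.mem_cons_of_mem _ hE)
      obtain ⟨π₂, he₂, h₂⟩ := Covers.combine (b := b) (P₃ := (D.subst x {y} p).Holds) he₁.der h₁
        ((hc D List.mem_cons_self).mono he₁.subset)
        (fun σ h1 h2 => h2.subst (by rw [h1, Finset.sum_singleton]))
        (fun _ _ h => (XorConstraint.Holds.congr h).1)
        (Finset.card_le_two.trans hb) (hP D List.mem_cons_self) hD
      refine ⟨π₂, (he₁.trans he₂).mono ?_, h₂⟩
      rw [List.length_cons, Nat.mul_succ]

theorem coversXor_of_cnf_subset {D : XorConstraint V} (h : ∀ C ∈ D.cnf, C ∈ π) :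
    CoversXor π L D := fun σ _ hD => by
  refine ⟨_, h _ (XorConstraint.mem_cnf_iff.2 ⟨σ, hD, rfl⟩), fun l hl => ?_⟩
  obtain ⟨x, hx, rfl⟩ := Finset.mem_image.1 hl
  exact ⟨by simp, Or.inl hx⟩

/-- Following a derivation vertex by vertex, resolution derives encodings of all labels whose
explanation is contained in `L`. -/
theorem XorDerivation.exists_covers {M : XorModule} {φxor ψ : Finset (XorConstraint V)}
    (G : XorDerivation M ψ) (Va : Set (Fin G.n)) {b : ℕ} (hb : 2 ≤ b)
    (hψ : ∀ D ∈ ψ, D.vars.card ≤ b) (hπ : IsResolutionDerivation F π)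
    (hF : ∀ D ∈ φxor, ∀ C ∈ D.cnf, C ∈ π) :
    ∃ π', Extends F π π' (2 ^ (3 * b) * G.size) ∧
      ∀ v, G.expl φxor Va v ⊆ L.image Lit.toXor → CoversXor π' L (G.label v) := by
  let g : ℕ → ℕ := fun i => if h : i < G.n then 1 + (G.prem ⟨i, h⟩).length else 0
  have hg : G.size = ∑ i ∈ Finset.range G.n, g i := by
    rw [Finset.sum_range]
    exact Finset.sum_congr rfl fun v _ => by simp [g]
  have key : ∀ m ≤ G.n, ∃ π', Extends F π π' (2 ^ (3 * b) * ∑ i ∈ Finset.range m, g i) ∧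
      ∀ v : Fin G.n, v.val < m → G.expl φxor Va v ⊆ L.image Lit.toXor →
        CoversXor π' L (G.label v) := by
    intro m
    induction m with
    | zero => exact fun _ => ⟨π, Extends.refl hπ _, fun v hv => absurd hv (Nat.not_lt_zero _)⟩
    | succ m ih =>
      intro hm
      obtain ⟨π₁, he₁, h₁⟩ := ih (Nat.le_of_succ_le hm)
      let v : Fin G.n := ⟨m, hm⟩
      have hv : ∃ π₂, Extends F π₁ π₂ (2 ^ (3 * b) * g m) ∧
          (G.expl φxor Va v ⊆ L.image Lit.toXor → CoversXor π₂ L (G.label v)) := by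
        have hlit : G.label v ∈ L.image Lit.toXor → CoversXor π₁ L (G.label v) := fun h => by
          obtain ⟨l, hl, h⟩ := Finset.mem_image.1 h
          exact h ▸ coversXor_of_mem hl
        by_cases hL : G.expl φxor Va v ⊆ L.image Lit.toXor
        swap
        · exact ⟨π₁, Extends.refl he₁.der _, fun h => absurd h hL⟩
        by_cases hi : G.IsInput v
        · refine ⟨π₁, Extends.refl he₁.der _, fun _ => ?_⟩
          rw [G.expl_of_isInput hi] at hL
          split_ifs at hL with hφ
          · exact coversXor_of_cnf_subset fun C hC => he₁.subset (hF _ hφ C hC)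
          · exact hlit (hL (by simp))
        by_cases ha : v ∈ Va
        · rw [G.expl_of_mem hi ha] at hL
          exact ⟨π₁, Extends.refl he₁.der _, fun _ => hlit (hL (by simp))⟩
        obtain ⟨π₂, he₂, h₂⟩ := (G.rule_of_not_isInput hi).exists_covers (L := L) hb
          (fun E hE => by
            obtain ⟨u, -, rfl⟩ := List.mem_map.1 hE
            exact G.card_vars_label_le hψ _) he₁.der
          (fun E hE => by
            obtain ⟨u, hu, rfl⟩ := List.mem_map.1 hE
            exact h₁ _ u.2 fun D hD => hL ((G.mem_expl_of_not_isInput hi ha).2 ⟨u, hu, hD⟩))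
        refine ⟨π₂, he₂.mono (Nat.mul_le_mul_left _ ?_), fun _ => h₂⟩
        simp [g, v, Nat.lt_of_succ_le hm]
      obtain ⟨π₂, he₂, h₂⟩ := hv
      refine ⟨π₂, (he₁.trans he₂).mono ?_, fun u hu hL => ?_⟩
      · rw [Finset.sum_range_succ, Nat.mul_add]
      · rcases Nat.lt_succ_iff_lt_or_eq.1 hu with h | h
        · exact (h₁ u h hL).mono he₂.subset
        · obtain rfl : u = v := Fin.ext h
          exact h₂ hL
  obtain ⟨π', he, h⟩ := key G.n le_rfl
  exact ⟨π', hg ▸ he, fun v => h v v.2⟩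

/-- A reported clause none of whose literals is true is subsumed by a clause that resolution derives
in a number of steps linear in the size of the derivation used. -/
theorem Reports.exists_subset {M : XorModule} {φxor : Finset (XorConstraint V)} {T : Set (Lit V)}
    {C : Clause V} {k b : ℕ} (h : Reports M φxor T C k) (hT : Consistent T)
    (hC : ∀ l ∈ C, l ∉ T) (hb : 2 ≤ b) (hφ : ∀ D ∈ φxor, D.vars.card ≤ b)
    (hπ : IsResolutionDerivation F π) (hF : ∀ D ∈ φxor, ∀ C ∈ D.cnf, C ∈ π) :
    ∃ π', Extends F π π' (2 ^ (3 * b) * k) ∧ ∃ C' ∈ π', C' ⊆ C := by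
  obtain ⟨A, G, Va, v, L, -, rfl, -, hL, hLT, hv⟩ := h
  obtain ⟨π', he, h'⟩ := G.exists_covers (L := L) (φxor := φxor) Va hb (fun D hD => by
    rcases Finset.mem_union.1 hD with h | h
    · exact hφ D h
    · obtain ⟨a, -, rfl⟩ := Finset.mem_image.1 h
      exact (Finset.card_singleton a.var).le.trans (by omega)) hπ hF
  refine ⟨π', he, ?_⟩
  have hc := h' v (by rw [hL])
  rcases hv with ⟨l, hl, rfl⟩ | ⟨hl, rfl⟩
  · have hT' : Consistent (insert l.neg T) := by
      have hlT : l ∉ T := hC l (by simp)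
      intro m hm
      rcases hm with rfl | hm
      · rintro (h | h)
        · exact Lit.neg_ne _ h
        · exact hlT (by simpa using h)
      · rintro (h | h)
        · exact hlT (Lit.neg_injective h ▸ hm)
        · exact hT m hm h
    rw [hl] at hc
    obtain ⟨σ, hm⟩ := hT'.exists_assignment
    have hσl : σ l.var = !l.sign := hm l.neg (Set.mem_insert _ _)
    obtain ⟨C, hC, hr⟩ := hc σ (fun m hmL => hm m (Set.mem_insert_of_mem _ (hLT m hmL))) (by
      rw [Lit.toXor_holds, hσl]; simp)
    refine ⟨C, hC, fun m hmC => ?_⟩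
    obtain ⟨h1, h2⟩ := hr m hmC
    rcases h2 with h2 | ⟨a, ha, h2⟩
    · have h2 : m.var = l.var := by simpa [Lit.toXor] using h2
      rw [h2, hσl] at h1
      rw [Lit.ext h2 (by cases hs : m.sign <;> cases hs' : l.sign <;> simp_all)]
      exact Finset.mem_insert_self _ _
    · refine Finset.mem_insert_of_mem (Finset.mem_image.2 ⟨a, ha, ?_⟩)
      rcases Lit.eq_or_eq_neg h2.symm with rfl | h3
      · exact absurd (hm _ (Set.mem_insert_of_mem _ (hLT _ ha))) h1
      · exact h3.symm
  · rw [hl] at hc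
    obtain ⟨σ, hm⟩ := hT.exists_assignment
    obtain ⟨C, hC, hr⟩ := hc σ (fun m hmL => hm m (hLT m hmL)) (by
      simp [XorConstraint.Holds, XorConstraint.bot, bit])
    refine ⟨C, hC, fun m hmC => ?_⟩
    obtain ⟨h1, h2⟩ := hr m hmC
    rcases h2 with h2 | ⟨a, ha, h2⟩
    · simp [XorConstraint.bot] at h2
    · refine Finset.mem_image.2 ⟨a, ha, ?_⟩
      rcases Lit.eq_or_eq_neg h2.symm with rfl | h3
      · exact absurd (hm _ (hLT _ ha)) h1
      · exact h3.symm

end Resolution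

/-! ### Trails -/

section Trails

variable {V : Type*}

@[simp] theorem Trail.lits_nil : Trail.lits ([] : Trail V) = ∅ := by
  simp [Trail.lits]

@[simp] theorem Trail.lits_cons (e : Lit V × Option (Clause V)) (t : Trail V) :
    Trail.lits (e :: t) = insert e.1 (Trail.lits t) := by
  ext l
  simp [Trail.lits]

theorem Trail.lits_append (p t : Trail V) :
    Trail.lits (p ++ t) = Trail.lits p ∪ Trail.lits t := by
  ext l
  simp only [Trail.lits, List.map_append, List.mem_append, Set.mem_ofPred_eq, Set.mem_union]

theorem Consistent.mono {T T' : Set (Lit V)} (h : Consistent T') (hT : T ⊆ T') : Consistent T :=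
  fun l hl hl' => h l (hT hl) (hT hl')

theorem Consistent.insert {T : Set (Lit V)} {l : Lit V} (h : Consistent T) (hl : l ∉ T)
    (hl' : l.neg ∉ T) : Consistent (insert l T) := by
  rintro m (rfl | hm) (hm' | hm')
  · exact Lit.neg_ne _ hm'
  · exact hl' hm'
  · exact hl' (by rwa [← hm', Lit.neg_neg])
  · exact h m hm hm'

theorem Trail.Unassigned.consistent_cons {t : Trail V} {l : Lit V} (hl : t.Unassigned l)
    (h : Consistent t.lits) (r : Option (Clause V)) : Consistent (Trail.lits ((l, r) :: t)) := by
  rw [Trail.lits_cons]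
  exact h.insert hl.1 hl.2

theorem Trail.MakesUnit.notMem {t : Trail V} {C : Clause V} {l : Lit V} (hl : t.MakesUnit C l)
    (h : Consistent t.lits) : ∀ m ∈ C, m ∉ t.lits := fun m hm hmt => by
  by_cases hml : m = l
  · exact hl.2.1.1 (hml ▸ hmt)
  · exact h m hmt (hl.2.2 m hm hml)

end Trails

/-! ### Resolution simulates the solver -/

section SolverToResolution

variable {V : Type*}

/-- Some clause of `π` is contained in `C`. -/
def Subsumed (π : List (Clause V)) (C : Clause V) : Prop := ∃ C' ∈ π, C' ⊆ C

/-- The trail is consistent, and all clauses of the database and all reasons are subsumed by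
clauses of `π`. -/
structure SearchSubsumed (π : List (Clause V)) (t : Trail V) (db : Finset (Clause V)) : Prop where
  consistent : Consistent t.lits
  db : ∀ C ∈ db, Subsumed π C
  reason : ∀ e ∈ t, ∀ R ∈ e.2, Subsumed π R

/-- All clauses that the solver holds in a state are subsumed by clauses of `π`. -/
def StateSubsumed (π : List (Clause V)) : State V → Prop
  | .search t db => SearchSubsumed π t db
  | .analyze t db C => SearchSubsumed π t db ∧ Subsumed π C
  | .unsat => ∅ ∈ π

theorem Subsumed.mono {π π' : List (Clause V)} {C : Clause V} (h : Subsumed π C) (hπ : π ⊆ π') :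
    Subsumed π' C :=
  let ⟨C', h1, h2⟩ := h
  ⟨C', hπ h1, h2⟩

theorem SearchSubsumed.mono {π π' : List (Clause V)} {t : Trail V} {db : Finset (Clause V)}
    (h : SearchSubsumed π t db) (hπ : π ⊆ π') : SearchSubsumed π' t db :=
  ⟨h.consistent, fun C hC => (h.db C hC).mono hπ, fun e he R hR => (h.reason e he R hR).mono hπ⟩

theorem SearchSubsumed.of_append {π : List (Clause V)} {p t : Trail V} {db : Finset (Clause V)}
    (h : SearchSubsumed π (p ++ t) db) : SearchSubsumed π t db :=
  ⟨h.consistent.mono (by rw [Trail.lits_append]; exact Set.subset_union_right), h.db,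
    fun e he => h.reason e (List.mem_append_right _ he)⟩

theorem SearchSubsumed.cons {π : List (Clause V)} {t : Trail V} {db : Finset (Clause V)}
    (h : SearchSubsumed π t db) {l : Lit V} (hl : t.Unassigned l) {r : Option (Clause V)}
    (hr : ∀ R ∈ r, Subsumed π R) : SearchSubsumed π ((l, r) :: t) db := by
  refine ⟨hl.consistent_cons h.consistent r, h.db, fun e he => ?_⟩
  rcases List.mem_cons.1 he with rfl | he
  · exact hr
  · exact h.reason e he

variable [DecidableEq V] {M : XorModule} {φ : CnfXor V} {eager : Bool} {F : Finset (Clause V)}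
  {π : List (Clause V)} {b : ℕ}

theorem Step.exists_extends {σ τ : State V} {k : ℕ} (h : Step M φ eager σ k τ) (hb : 2 ≤ b)
    (hφ : φ.XorWidthLE b) (hπ : IsResolutionDerivation F π)
    (hF : ∀ D ∈ φ.xors, ∀ C ∈ D.cnf, C ∈ π) (hσ : StateSubsumed π σ) :
    ∃ π', Extends F π π' (2 ^ (3 * b) * k) ∧ StateSubsumed π' τ := by
  have hpos : 1 ≤ 2 ^ (3 * b) := Nat.one_le_two_pow
  cases h with
  | decide t db l hv hl hs =>
    exact ⟨π, Extends.refl hπ _, SearchSubsumed.cons hσ hl (by simp)⟩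
  | propagate t db C l hC hl =>
    exact ⟨π, Extends.refl hπ _, SearchSubsumed.cons hσ hl.2.1 (by simpa using hσ.db C hC)⟩
  | xorPropagate t db C l k hC hl =>
    obtain ⟨π', he, hC'⟩ := hC.exists_subset hσ.consistent (hl.notMem hσ.consistent) hb hφ hπ hF
    refine ⟨π', he.mono (Nat.mul_le_mul_left _ (Nat.le_add_left _ _)), ?_⟩
    exact (SearchSubsumed.mono hσ he.subset).cons hl.2.1 (by simpa [Subsumed] using hC')
  | conflict t db C hC hf =>
    exact ⟨π, Extends.refl hπ _, hσ, hσ.db C hC⟩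
  | xorConflict t db C k hC hf =>
    obtain ⟨π', he, hC'⟩ := hC.exists_subset hσ.consistent
      (fun l hl hlt => hσ.consistent l hlt (hf l hl)) hb hφ hπ hF
    exact ⟨π', he.mono (Nat.mul_le_mul_left _ (Nat.le_add_left _ _)),
      SearchSubsumed.mono hσ he.subset, hC'⟩
  | skip t db C l r hl =>
    exact ⟨π, Extends.refl hπ _, SearchSubsumed.of_append (p := [(l, r)]) hσ.1, hσ.2⟩
  | resolve t db C R l hl =>
    obtain ⟨R', hR', hR⟩ := hσ.1.reason _ List.mem_cons_self R rfl
    obtain ⟨C', hC', hC⟩ := hσ.2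
    obtain ⟨π', he, h'⟩ := hπ.exists_subset_resolvent (l := l) hR' hC' hR hC
    exact ⟨π', he.mono (by omega),
      (SearchSubsumed.of_append (p := [(l, some R)]) hσ.1).mono he.subset, h'⟩
  | learn t t' p db C l d r hl ht ha =>
    refine ⟨π, Extends.refl hπ _, ?_⟩
    have h1 := hσ.1
    rw [ht, List.append_cons] at h1
    have h2 := h1.of_append
    refine ⟨h2.consistent, fun C' hC' => ?_, h2.reason⟩
    rcases Finset.mem_insert.1 hC' with rfl | hC'
    · exact hσ.2
    · exact h2.db C' hC'
  | restart t' p db d h0 =>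
    refine ⟨π, Extends.refl hπ _, ?_⟩
    have h1 : SearchSubsumed π (p ++ (d, none) :: t') db := hσ
    rw [List.append_cons] at h1
    exact h1.of_append
  | fail t db =>
    refine ⟨π, Extends.refl hπ _, ?_⟩
    obtain ⟨C, hC, hC'⟩ := hσ.2
    rw [Finset.subset_empty.1 hC'] at hC
    exact hC

theorem Run.exists_extends {σ τ : State V} {s : ℕ} (h : Run M φ eager σ s τ) (hb : 2 ≤ b)
    (hφ : φ.XorWidthLE b) :
    ∀ π : List (Clause V), IsResolutionDerivation F π → (∀ D ∈ φ.xors, ∀ C ∈ D.cnf, C ∈ π) →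
      StateSubsumed π σ → ∃ π', Extends F π π' (2 ^ (3 * b) * s) ∧ StateSubsumed π' τ := by
  induction h with
  | refl σ => exact fun π hπ _ hσ => ⟨π, Extends.refl hπ _, hσ⟩
  | step σ τ ρ k s h hr ih =>
    intro π hπ hF hσ
    obtain ⟨π₁, he₁, h₁⟩ := h.exists_extends hb hφ hπ hF hσ
    obtain ⟨π₂, he₂, h₂⟩ := ih π₁ he₁.der (fun D hD C hC => he₁.subset (hF D hD C hC)) h₁
    exact ⟨π₂, (he₁.trans he₂).mono (by rw [Nat.mul_add]), h₂⟩

theorem CnfXor.card_toCnf_le {w : ℕ} (hφ : φ.XorWidthLE w) :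
    φ.toCnf.card ≤ 2 ^ w * φ.size := by
  have h1 : φ.clauses.card ≤ ∑ C ∈ φ.clauses, (1 + C.card) := by
    rw [Finset.card_eq_sum_ones]
    exact Finset.sum_le_sum fun C _ => Nat.le_add_right _ _
  have h2 : (φ.xors.biUnion XorConstraint.cnf).card ≤
      2 ^ w * ∑ D ∈ φ.xors, (1 + D.vars.card) := by
    refine Finset.card_biUnion_le.trans ?_
    rw [Finset.mul_sum]
    refine Finset.sum_le_sum fun D hD => ?_
    refine D.card_cnf_le.trans ((Nat.pow_le_pow_right (by norm_num) (hφ D hD)).trans ?_)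
    exact Nat.le_mul_of_pos_right _ (by omega)
  refine (Finset.card_union_le _ _).trans ?_
  rw [CnfXor.size, Nat.mul_add]
  exact Nat.add_le_add (h1.trans (Nat.le_mul_of_pos_left _ (by positivity))) h2

theorem DpllXorRefutes.exists_resolutionRefutes {w s : ℕ} (hφ : φ.XorWidthLE w)
    (h : DpllXorRefutes M eager φ s) :
    ∃ s' ≤ 2 ^ w * φ.size + 2 ^ (3 * (w + 2)) * s, ResolutionRefutes φ.toCnf s' := by
  have hmem : ∀ C ∈ φ.toCnf, C ∈ φ.toCnf.toList := fun C hC => Finset.mem_toList.2 hC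
  have hF : ∀ D ∈ φ.xors, ∀ C ∈ D.cnf, C ∈ φ.toCnf.toList := fun D hD C hC =>
    hmem C (Finset.mem_union_right _ (Finset.mem_biUnion.2 ⟨D, hD, hC⟩))
  obtain ⟨π, he, hπ⟩ := Run.exists_extends (F := φ.toCnf) h (b := w + 2) (by omega)
    (fun D hD => (hφ D hD).trans (by omega)) φ.toCnf.toList (isResolutionDerivation_toList _) hF
    ⟨by simp [Consistent], fun C hC => ⟨C, hmem C (Finset.mem_union_left _ hC), subset_rfl⟩,
      by simp⟩
  refine ⟨π.length, he.length_le.trans ?_, π, he.der, hπ, rfl⟩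
  rw [Finset.length_toList]
  exact Nat.add_le_add_right (CnfXor.card_toCnf_le hφ) _

end SolverToResolution

/-! ### Short paths of binary constraints -/

section ShortPaths

variable {V : Type*} [DecidableEq V]

/-- The parity graph of a set of xor-constraints: an edge between `(x, c)` and `(y, d)` says that
a binary constraint in `S` makes `x ≡ c` and `y ≡ d` equivalent. -/
def parityGraph (S : Set (XorConstraint V)) : SimpleGraph (V × Bool) where
  Adj u v := u.1 ≠ v.1 ∧ ⟨{u.1, v.1}, xor u.2 v.2⟩ ∈ S
  symm := ⟨fun u v h => ⟨h.1.symm, by rw [Finset.pair_comm, Bool.xor_comm]; exact h.2⟩⟩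
  loopless := ⟨fun _ h => h.1 rfl⟩

variable {S : Set (XorConstraint V)}

theorem EqvPath.reachable {x y : V} {p : Bool} {K : List (XorConstraint V)}
    (h : EqvPath x y p K) :
    (∀ E ∈ K, E ∈ S) → ∀ c : Bool, (parityGraph S).Reachable (x, c) (y, xor c p) := by
  induction h with
  | single x y p hxy =>
    intro hK c
    refine SimpleGraph.Adj.reachable (G := parityGraph S) ⟨hxy, ?_⟩
    simpa using hK
  | cons x y z p q K hxy h ih =>
    intro hK c
    have h1 : (parityGraph S).Adj (x, c) (y, xor c p) :=
      ⟨hxy, by simpa using hK _ List.mem_cons_self⟩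
    have h2 := ih (fun E hE => hK E (List.mem_cons_of_mem _ hE)) (xor c p)
    rw [Bool.xor_assoc] at h2
    exact h1.reachable.trans h2

theorem exists_eqvPath_of_walk {u v : V × Bool} (W : (parityGraph S).Walk u v) :
    W.length ≠ 0 → ∃ K, EqvPath u.1 v.1 (xor u.2 v.2) K ∧ K.length = W.length ∧
      ∀ E ∈ K, E ∈ S := by
  induction W with
  | nil => exact fun h => absurd rfl h
  | @cons a e d h W ih =>
    intro _
    by_cases hW : W.length = 0
    · obtain rfl := SimpleGraph.Walk.eq_of_length_eq_zero hW
      exact ⟨_, EqvPath.single _ _ _ h.1, by simp [hW], by simpa using h.2⟩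
    · obtain ⟨K, hK, hl, hS⟩ := ih hW
      have := EqvPath.cons a.1 e.1 d.1 (xor a.2 e.2) _ K h.1 hK
      rw [show xor (xor a.2 e.2) (xor e.2 d.2) = xor a.2 d.2 by simp] at this
      refine ⟨_, this, by simp [hl], ?_⟩
      rintro E (_ | ⟨_, hE⟩)
      · exact h.2
      · exact hS E hE

theorem fst_mem_of_mem_support {u v : V × Bool} (W : (parityGraph S).Walk u v) {Z : Finset V}
    (hS : ∀ E ∈ S, E.vars ⊆ Z) (hu : u.1 ∈ Z) : ∀ a ∈ W.support, a.1 ∈ Z := by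
  induction W with
  | nil => simpa using hu
  | cons h W ih =>
    intro a ha
    rw [SimpleGraph.Walk.support_cons] at ha
    rcases List.mem_cons.1 ha with rfl | ha
    · exact hu
    · exact ih (hS _ h.2 (by simp)) a ha

/-- A path of binary constraints may be replaced by one that visits each pair of a variable and a
parity at most once. -/
theorem EqvPath.exists_short {x y : V} {p : Bool} {K : List (XorConstraint V)}
    (h : EqvPath x y p K) (hxy : x ≠ y) {Z : Finset V} (hx : x ∈ Z)
    (hK : ∀ E ∈ K, E.vars ⊆ Z) :
    ∃ K', EqvPath x y p K' ∧ K'.length ≤ 2 * Z.card ∧ ∀ E ∈ K', E ∈ K := by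
  obtain ⟨W, hW⟩ := (h.reachable (S := {E | E ∈ K}) (fun _ h => h) false).exists_isPath
  have hlen : W.length ≠ 0 := fun h0 =>
    hxy (congrArg Prod.fst (SimpleGraph.Walk.eq_of_length_eq_zero h0))
  obtain ⟨K', hK', hl, hS⟩ := exists_eqvPath_of_walk W hlen
  refine ⟨K', by simpa using hK', ?_, hS⟩
  have h1 : W.support.toFinset ⊆ Z ×ˢ (Finset.univ : Finset Bool) := fun a ha => by
    have := fst_mem_of_mem_support W (Z := Z) hK hx a (List.mem_toFinset.1 ha)
    simpa using this
  have h2 := Finset.card_le_card h1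
  rw [List.toFinset_card_of_nodup hW.support_nodup, SimpleGraph.Walk.length_support,
    Finset.card_product, Finset.card_univ, Fintype.card_bool] at h2
  omega

theorem XorModule.Rule.exists_short {M : XorModule} {P : List (XorConstraint V)}
    {D : XorConstraint V} (h : M.Rule P D) {Z : Finset V} (hP : ∀ E ∈ P, E.vars ⊆ Z) :
    ∃ P', M.Rule P' D ∧ P'.length ≤ 2 * Z.card + 2 ∧ ∀ E ∈ P', E ∈ P := by
  cases M with
  | subst => exact ⟨P, h, by cases h <;> simp, fun _ h => h⟩
  | ec =>
    cases h with
    | unit x p D hx => exact ⟨_, .unit x p D hx, by simp, fun _ h => h⟩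
    | path x y p K D hK hxy hx hy =>
      obtain ⟨K', hK', hl, hS⟩ := hK.exists_short hxy (hP D List.mem_cons_self hx)
        fun E hE => hP E (List.mem_cons_of_mem _ hE)
      refine ⟨D :: K', .path x y p K' D hK' hxy hx hy, by simp; omega, ?_⟩
      rintro E (_ | ⟨_, hE⟩)
      · exact List.mem_cons_self
      · exact List.mem_cons_of_mem _ (hS E hE)

end ShortPaths

/-! ### Derivable constraints have small derivations -/

section SmallDerivations

variable {V : Type*} [DecidableEq V]

/-- The xor-constraint is derivable from `ψ` by the rules of the module `M`. -/
inductive Derivable (M : XorModule) (ψ : Set (XorConstraint V)) : XorConstraint V → Prop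
  | input (D : XorConstraint V) (h : D ∈ ψ) : Derivable M ψ D
  | rule (P : List (XorConstraint V)) (D : XorConstraint V) (h : M.Rule P D)
      (hP : ∀ E ∈ P, Derivable M ψ E) : Derivable M ψ D

variable {M : XorModule} {ψ ψ' : Set (XorConstraint V)} {D : XorConstraint V}

theorem Derivable.mono (h : Derivable M ψ D) (hψ : ψ ⊆ ψ') : Derivable M ψ' D := by
  induction h with
  | input D h => exact .input D (hψ h)
  | rule P D h _ ih => exact .rule P D h ih

theorem Derivable.card_le (h : Derivable M ψ D) {b : ℕ} (hψ : ∀ E ∈ ψ, E.vars.card ≤ b) :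
    D.vars.card ≤ b := by
  induction h with
  | input D h => exact hψ D h
  | rule P D h _ ih => exact h.card_le ih

theorem Derivable.vars_subset (h : Derivable M ψ D) {Z : Finset V} (hψ : ∀ E ∈ ψ, E.vars ⊆ Z) :
    D.vars ⊆ Z := by
  induction h with
  | input D h => exact hψ D h
  | rule P D h _ ih => exact h.vars_subset ih

/-- A derivation written as a list of distinct xor-constraints, each of them a member of `ψ` or
inferred by a rule from at most `q` earlier ones. -/
inductive DerivationList (M : XorModule) (ψ : Set (XorConstraint V)) (q : ℕ) :
    List (XorConstraint V) → Prop
  | nil : DerivationList M ψ q []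
  | snoc (ℓ : List (XorConstraint V)) (D : XorConstraint V) (hℓ : DerivationList M ψ q ℓ)
      (hD : D ∉ ℓ)
      (h : D ∈ ψ ∨ ∃ P, M.Rule P D ∧ P.length ≤ q ∧ ∀ E ∈ P, E ∈ ℓ) :
      DerivationList M ψ q (ℓ ++ [D])

theorem DerivationList.nodup {q : ℕ} {ℓ : List (XorConstraint V)} (h : DerivationList M ψ q ℓ) :
    ℓ.Nodup := by
  induction h with
  | nil => exact List.nodup_nil
  | snoc ℓ D _ hD _ ih => exact List.nodup_append_comm.1 (by simpa using ⟨hD, ih⟩)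

theorem DerivationList.derivable {q : ℕ} {ℓ : List (XorConstraint V)}
    (h : DerivationList M ψ q ℓ) : ∀ D ∈ ℓ, Derivable M ψ D := by
  induction h with
  | nil => simp
  | snoc ℓ D _ _ h ih =>
    intro E hE
    rcases List.mem_append.1 hE with hE | hE
    · exact ih E hE
    · obtain rfl := List.mem_singleton.1 hE
      rcases h with h | ⟨P, hP, -, hPℓ⟩
      · exact .input _ h
      · exact .rule P _ hP fun E' hE' => ih E' (hPℓ E' hE')

theorem exists_finset_card_le_pow (Z : Finset V) (b : ℕ) :
    ∃ 𝒮 : Finset (Finset V), 𝒮.card ≤ (Z.card + 1) ^ b ∧ ∀ X ⊆ Z, X.card ≤ b → X ∈ 𝒮 := by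
  induction b with
  | zero => exact ⟨{∅}, by simp, by simp⟩
  | succ b ih =>
    obtain ⟨𝒮, h1, h2⟩ := ih
    refine ⟨𝒮 ∪ (Z ×ˢ 𝒮).image fun a => insert a.1 a.2, ?_, fun X hX hb => ?_⟩
    · refine (Finset.card_union_le _ _).trans ?_
      have h3 : ((Z ×ˢ 𝒮).image fun a => insert a.1 a.2).card ≤ Z.card * 𝒮.card :=
        Finset.card_image_le.trans (Finset.card_product _ _).le
      calc _ ≤ 𝒮.card + Z.card * 𝒮.card := Nat.add_le_add_left h3 _
        _ = 𝒮.card * (Z.card + 1) := by ring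
        _ ≤ (Z.card + 1) ^ b * (Z.card + 1) := Nat.mul_le_mul_right _ h1
        _ = (Z.card + 1) ^ (b + 1) := (pow_succ _ _).symm
    · rcases X.eq_empty_or_nonempty with rfl | ⟨x, hx⟩
      · exact Finset.mem_union_left _ (h2 _ hX (by simp))
      · refine Finset.mem_union_right _ (Finset.mem_image.2 ⟨(x, X.erase x), ?_, ?_⟩)
        · refine Finset.mem_product.2 ⟨hX hx, h2 _ ((Finset.erase_subset _ _).trans hX) ?_⟩
          rw [Finset.card_erase_of_mem hx]
          omega
        · exact Finset.insert_erase hx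

theorem length_le_of_nodup {ℓ : List (XorConstraint V)} (hℓ : ℓ.Nodup) {Z : Finset V} {b : ℕ}
    (hb : ∀ D ∈ ℓ, D.vars.card ≤ b) (hZ : ∀ D ∈ ℓ, D.vars ⊆ Z) :
    ℓ.length ≤ 2 * (Z.card + 1) ^ b := by
  obtain ⟨𝒮, h1, h2⟩ := exists_finset_card_le_pow Z b
  have h3 : ℓ.toFinset ⊆ (𝒮 ×ˢ (Finset.univ : Finset Bool)).image fun a => ⟨a.1, a.2⟩ :=
    fun D hD => by
      have hD := List.mem_toFinset.1 hD
      exact Finset.mem_image.2 ⟨(D.vars, D.parity),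
        Finset.mem_product.2 ⟨h2 _ (hZ D hD) (hb D hD), Finset.mem_univ _⟩, rfl⟩
  have h4 := (Finset.card_le_card h3).trans Finset.card_image_le
  rw [List.toFinset_card_of_nodup hℓ, Finset.card_product, Finset.card_univ,
    Fintype.card_bool] at h4
  omega

/-- As long as a derivation list misses a derivable constraint, it can be extended; since its length
is bounded, some derivation list contains all derivable constraints. -/
theorem exists_derivationList {Z : Finset V} {b : ℕ} (hb : ∀ D ∈ ψ, D.vars.card ≤ b)
    (hZ : ∀ D ∈ ψ, D.vars ⊆ Z) :
    ∃ ℓ, DerivationList M ψ (2 * Z.card + 2) ℓ ∧ ∀ D, Derivable M ψ D → D ∈ ℓ := by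
  by_contra! hno
  have key : ∀ m : ℕ, ∃ ℓ, DerivationList M ψ (2 * Z.card + 2) ℓ ∧ ℓ.length = m := by
    intro m
    induction m with
    | zero => exact ⟨[], .nil, rfl⟩
    | succ m ih =>
      obtain ⟨ℓ, hℓ, hm⟩ := ih
      obtain ⟨D, hD, hDℓ⟩ := hno ℓ hℓ
      by_contra! hmax
      have hclosed : ∀ E, E ∈ ψ ∨ (∃ P, M.Rule P E ∧ P.length ≤ 2 * Z.card + 2 ∧ ∀ E' ∈ P, E' ∈ ℓ) →
          E ∈ ℓ := fun E hE => by
        by_contra hEℓ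
        exact hmax _ (.snoc ℓ E hℓ hEℓ hE) (by simp [hm])
      refine hDℓ ?_
      clear hDℓ
      induction hD with
      | input D h => exact hclosed D (Or.inl h)
      | rule P D h hP ih =>
        obtain ⟨P', hP', hl, hsub⟩ := h.exists_short fun E hE => (hP E hE).vars_subset hZ
        exact hclosed D (Or.inr ⟨P', hP', hl, fun E hE => ih E (hsub E hE)⟩)
  obtain ⟨ℓ, hℓ, hm⟩ := key (2 * (Z.card + 1) ^ b + 1)
  have := length_le_of_nodup hℓ.nodup (fun D hD => (hℓ.derivable D hD).card_le hb)
    fun D hD => (hℓ.derivable D hD).vars_subset hZ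
  omega

theorem DerivationList.getElem {q : ℕ} {ℓ : List (XorConstraint V)}
    (h : DerivationList M ψ q ℓ) :
    ∀ (i : ℕ) (hi : i < ℓ.length), ℓ[i] ∈ ψ ∨
      ∃ P, M.Rule P ℓ[i] ∧ P.length ≤ q ∧ ∀ E ∈ P, ∃ (j : ℕ) (hj : j < i), ℓ[j] = E := by
  induction h with
  | nil => exact fun i hi => absurd hi (Nat.not_lt_zero i)
  | snoc ℓ D _ _ h ih =>
    intro i hi
    by_cases hil : i < ℓ.length
    · rw [List.getElem_append_left hil]
      refine (ih i hil).imp_right ?_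
      rintro ⟨P, h1, h2, h3⟩
      refine ⟨P, h1, h2, fun E hE => ?_⟩
      obtain ⟨j, hj, rfl⟩ := h3 E hE
      exact ⟨j, hj, List.getElem_append_left (hj.trans hil)⟩
    · have hi' : i = ℓ.length := by simp at hi; omega
      subst hi'
      simp only [List.getElem_concat_length]
      refine h.imp_right ?_
      rintro ⟨P, h1, h2, h3⟩
      refine ⟨P, h1, h2, fun E hE => ?_⟩
      obtain ⟨j, hj, rfl⟩ := List.getElem_of_mem (h3 E hE)
      exact ⟨j, hj, List.getElem_append_left hj⟩

theorem exists_map_eq_of_forall_mem {α β : Type*} (f : α → β) (P : List β)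
    (h : ∀ E ∈ P, ∃ a, f a = E) : ∃ Q : List α, Q.map f = P := by
  induction P with
  | nil => exact ⟨[], rfl⟩
  | cons E P ih =>
    obtain ⟨a, rfl⟩ := h E List.mem_cons_self
    obtain ⟨Q, rfl⟩ := ih fun E hE => h E (List.mem_cons_of_mem _ hE)
    exact ⟨a :: Q, rfl⟩

theorem DerivationList.exists_xorDerivation {ψ : Finset (XorConstraint V)} {q : ℕ}
    {ℓ : List (XorConstraint V)} (h : DerivationList M (ψ : Set (XorConstraint V)) q ℓ) :
    ∃ G : XorDerivation M ψ, G.size ≤ ℓ.length * (1 + q) ∧ ∀ D ∈ ℓ, ∃ v, G.label v = D := by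
  have key : ∀ v : Fin ℓ.length, ∃ P : List (Fin v), P.length ≤ q ∧
      ((P = [] ∧ ℓ[v] ∈ ψ) ∨
        (P ≠ [] ∧ M.Rule (P.map fun u : Fin v => ℓ[u.val]'(u.2.trans v.2)) ℓ[v])) := by
    intro v
    rcases h.getElem v v.2 with h | ⟨P, h1, h2, h3⟩
    · exact ⟨[], by simp, Or.inl ⟨rfl, h⟩⟩
    · obtain ⟨Q, rfl⟩ := exists_map_eq_of_forall_mem
        (fun u : Fin v => ℓ[u.val]'(u.2.trans v.2)) P fun E hE => by
          obtain ⟨j, hj, h⟩ := h3 E hE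
          exact ⟨⟨j, hj⟩, h⟩
      refine ⟨Q, by simpa using h2, Or.inr ⟨?_, h1⟩⟩
      rintro rfl
      exact h1.ne_nil rfl
  choose prem hlen hvalid using key
  refine ⟨⟨ℓ.length, fun v => ℓ[v], prem, hvalid⟩, ?_, fun D hD => ?_⟩
  · refine (Finset.sum_le_card_nsmul Finset.univ _ (1 + q) fun v _ =>
      Nat.add_le_add_left (hlen v) 1).trans ?_
    simp
  · obtain ⟨i, hi, rfl⟩ := List.getElem_of_mem hD
    exact ⟨⟨i, hi⟩, rfl⟩

end SmallDerivations

/-! ### What the xor module can report -/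

section Reporting

variable {V : Type*} [DecidableEq V] {M : XorModule} {φxor : Finset (XorConstraint V)}

/-- The xor-constraint is derivable by the module from `φxor` and the literals in `T`. -/
def XorImplies (M : XorModule) (φxor : Finset (XorConstraint V)) (T : Set (Lit V))
    (D : XorConstraint V) : Prop :=
  Derivable M (↑φxor ∪ Lit.toXor '' T) D

theorem XorImplies.mono {T T' : Set (Lit V)} {D : XorConstraint V} (h : XorImplies M φxor T D)
    (hT : T ⊆ T') : XorImplies M φxor T' D :=
  Derivable.mono h (Set.union_subset_union_right _ (Set.image_mono hT))

/-- The label of a vertex follows from `φxor` and the explanation of the vertex. -/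
theorem XorDerivation.derivable_expl {ψ : Finset (XorConstraint V)} (G : XorDerivation M ψ)
    (Va : Set (Fin G.n)) (v : Fin G.n) :
    Derivable M (↑φxor ∪ ↑(G.expl φxor Va v)) (G.label v) := by
  induction hv : v.val using Nat.strong_induction_on generalizing v with
  | _ m ih =>
    by_cases hi : G.IsInput v
    · rw [G.expl_of_isInput hi]
      refine .input _ ?_
      split_ifs with h
      · exact Or.inl h
      · exact Or.inr (by simp)
    · by_cases ha : v ∈ Va
      · rw [G.expl_of_mem hi ha]
        exact .input _ (Or.inr (by simp))
      · refine .rule _ _ (G.rule_of_not_isInput hi) fun E hE => ?_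
        obtain ⟨u, hu, rfl⟩ := List.mem_map.1 hE
        refine (ih u (hv ▸ u.2) ⟨u, u.2.trans v.2⟩ rfl).mono (Set.union_subset_union_right _ ?_)
        exact fun D hD => (G.mem_expl_of_not_isInput hi ha).2 ⟨u, hu, hD⟩

theorem Reports.exists_xorImplies {T : Set (Lit V)} {C : Clause V} {k : ℕ}
    (h : Reports M φxor T C k) :
    ∃ L : Finset (Lit V), (∀ m ∈ L, m ∈ T) ∧
      ((∃ l : Lit V, XorImplies M φxor ↑L l.toXor ∧ C = insert l (L.image Lit.neg)) ∨
        (XorImplies M φxor ↑L (XorConstraint.bot V) ∧ C = L.image Lit.neg)) := by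
  obtain ⟨A, G, Va, v, L, -, -, -, hL, hLT, hv⟩ := h
  have h1 := G.derivable_expl (φxor := φxor) Va v
  rw [hL, Finset.coe_image] at h1
  refine ⟨L, hLT, ?_⟩
  rcases hv with ⟨l, hl, hC⟩ | ⟨hl, hC⟩
  · exact Or.inl ⟨l, by rwa [XorImplies, ← hl], hC⟩
  · exact Or.inr ⟨by rwa [XorImplies, ← hl], hC⟩

/-- Under the cut whose upper part consists of the input vertices, the explanations consist of
xor-assumptions. -/
theorem XorDerivation.expl_inputs_subset {A : Finset (Lit V)}
    (G : XorDerivation M (φxor ∪ A.image Lit.toXor)) (v : Fin G.n) :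
    G.expl φxor {u | G.IsInput u} v ⊆ A.image Lit.toXor := by
  induction hv : v.val using Nat.strong_induction_on generalizing v with
  | _ m ih =>
    by_cases hi : G.IsInput v
    · rw [G.expl_of_isInput hi]
      split_ifs with h
      · exact Finset.empty_subset _
      · exact Finset.singleton_subset_iff.2
          ((Finset.mem_union.1 (G.label_mem_of_isInput hi)).resolve_left h)
    · intro D hD
      obtain ⟨u, -, hD⟩ := (G.mem_expl_of_not_isInput hi (by exact hi)).1 hD
      exact ih u (hv ▸ u.2) ⟨u, u.2.trans v.2⟩ rfl hD

/-- A bound on the sizes of the derivations that report everything that can be reported, for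
formulas with `n` variables and constraints with at most `b` variables. -/
def reportBound (b n : ℕ) : ℕ := 2 * (n + 1) ^ b * (2 * n + 3)

/-- A derivable literal that is not yet true, or a derivable contradiction, can be reported with a
small derivation. The function `f` turns an explanation into the clause to be reported, so that the
two kinds of reported clauses are treated alike. -/
theorem exists_reports_of_xorImplies {A : Finset (Lit V)} {D : XorConstraint V} {b : ℕ}
    {Z : Finset V} {f : Finset (Lit V) → Clause V} (h : XorImplies M φxor ↑A D)
    (hDA : D ∉ A.image Lit.toXor) (hb1 : 1 ≤ b) (hb : ∀ E ∈ φxor, E.vars.card ≤ b)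
    (hZ : ∀ E ∈ φxor, E.vars ⊆ Z) (hA : ∀ a ∈ A, a.var ∈ Z)
    (hf : ∀ L, (∃ l : Lit V, D = l.toXor ∧ f L = insert l (L.image Lit.neg)) ∨
      (D = XorConstraint.bot V ∧ f L = L.image Lit.neg)) :
    ∃ L ⊆ A, XorImplies M φxor ↑L D ∧
      ∃ k ≤ reportBound b Z.card, Reports M φxor ↑A (f L) k := by
  have hψ : (↑φxor ∪ Lit.toXor '' (A : Set (Lit V)) : Set (XorConstraint V)) =
      ↑(φxor ∪ A.image Lit.toXor) := by simp
  rw [XorImplies, hψ] at h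
  have hcard : ∀ E ∈ (↑(φxor ∪ A.image Lit.toXor) : Set (XorConstraint V)),
      E.vars.card ≤ b := fun E hE => by
    rcases Finset.mem_union.1 hE with hE | hE
    · exact hb E hE
    · obtain ⟨a, -, rfl⟩ := Finset.mem_image.1 hE
      exact (Finset.card_singleton a.var).le.trans hb1
  have hvars : ∀ E ∈ (↑(φxor ∪ A.image Lit.toXor) : Set (XorConstraint V)),
      E.vars ⊆ Z := fun E hE => by
    rcases Finset.mem_union.1 hE with hE | hE
    · exact hZ E hE
    · obtain ⟨a, ha, rfl⟩ := Finset.mem_image.1 hE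
      exact Finset.singleton_subset_iff.2 (hA a ha)
  obtain ⟨ℓ, hℓ, hall⟩ := exists_derivationList (M := M) hcard hvars
  have hlen := length_le_of_nodup hℓ.nodup (fun D hD => (hℓ.derivable D hD).card_le hcard)
    fun D hD => (hℓ.derivable D hD).vars_subset hvars
  obtain ⟨G, hsize, hG⟩ := hℓ.exists_xorDerivation
  obtain ⟨v, hv⟩ := hG D (hall D h)
  set Va : Set (Fin G.n) := {u | G.IsInput u} with hVa
  obtain ⟨L, hLA, hL⟩ := Finset.subset_image_iff.1 (G.expl_inputs_subset v)
  have himp := G.derivable_expl (φxor := φxor) Va v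
  rw [← hL, hv, Finset.coe_image] at himp
  refine ⟨L, hLA, himp, G.size, ?_, A, G, Va, v, L, fun a ha => ha, rfl, ?_, hL.symm,
    fun l hl => hLA hl, ?_⟩
  · refine hsize.trans ?_
    rw [reportBound, show 1 + (2 * Z.card + 2) = 2 * Z.card + 3 by ring]
    exact Nat.mul_le_mul_right _ hlen
  · by_cases hi : G.IsInput v
    · exact Or.inl ⟨hi, (Finset.mem_union.1 (G.label_mem_of_isInput hi)).resolve_right
        (by rwa [hv])⟩
    · refine Or.inr ⟨hi, ⟨hi, fun u hu _ => hu⟩, fun u hu w _ _ => ?_⟩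
      rcases Finset.mem_union.1 (G.label_mem_of_isInput hu) with h | h
      · exact Or.inl ⟨hu, h⟩
      · obtain ⟨a, -, ha⟩ := Finset.mem_image.1 h
        exact Or.inr (by rw [← ha]; exact Finset.card_singleton _)
  · rw [hv]
    exact hf L

end Reporting

/-! ### Propagation and absorbed clauses -/

section Negations

variable {V : Type*}

/-- No literal of the trail is a decision. -/
def Trail.DecisionFree (t : Trail V) : Prop := ∀ e ∈ t, e.2 ≠ none

theorem Trail.decisionFree_or_exists_eq_append (t : Trail V) :
    t.DecisionFree ∨ ∃ p d t', t = p ++ (d, none) :: t' ∧ Trail.DecisionFree t' := by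
  induction t with
  | nil => exact Or.inl (by simp [Trail.DecisionFree])
  | cons e t ih =>
    rcases ih with ih | ⟨p, d, t', rfl, h⟩
    · obtain ⟨d, r⟩ := e
      cases r with
      | none => exact Or.inr ⟨[], d, t, rfl, ih⟩
      | some R =>
        refine Or.inl fun e he => ?_
        rcases List.mem_cons.1 he with rfl | he
        exacts [Option.some_ne_none R, ih e he]
    · exact Or.inr ⟨e :: p, d, t', rfl, h⟩

/-- The literals whose negations are in `C`; making them true is falsifying `C`. -/
def Clause.negs (C : Clause V) : Set (Lit V) := {m | m.neg ∈ C}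

theorem Clause.neg_mem_negs {C : Clause V} {l : Lit V} (h : l ∈ C) : l.neg ∈ Clause.negs C := by
  simpa [Clause.negs] using h

theorem Clause.negs_mono {A B : Clause V} (h : A ⊆ B) : Clause.negs A ⊆ Clause.negs B :=
  fun _ hm => h hm

theorem Trail.Falsifies.negs_subset {t : Trail V} {K : Clause V} (h : t.Falsifies K) :
    Clause.negs K ⊆ t.lits := fun m hm => by
  simpa using h _ hm

theorem Trail.Unassigned.var_notMem {t : Trail V} {l : Lit V} (hl : t.Unassigned l) :
    l.var ∉ t.map fun e => e.1.var := fun h => by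
  obtain ⟨e, he, hv⟩ := List.mem_map.1 h
  have he' : e.1 ∈ t.lits := List.mem_map.2 ⟨e, he, rfl⟩
  rcases Lit.eq_or_eq_neg hv with h | h
  · exact hl.1 (h ▸ he')
  · exact hl.2 (h ▸ he')

end Negations

section Propagation

variable {V : Type*} [DecidableEq V]

/-- The literals implied by `T` under unit propagation with the clauses of `db`, together with the
inferences of the xor module on `φxor`. -/
inductive Propagates (M : XorModule) (φxor : Finset (XorConstraint V)) (db : Finset (Clause V))
    (T : Set (Lit V)) : Lit V → Prop
  | base (l : Lit V) (h : l ∈ T) : Propagates M φxor db T l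
  | clause (C : Clause V) (l : Lit V) (hC : C ∈ db) (hl : l ∈ C)
      (h : ∀ l' ∈ C, l' ≠ l → Propagates M φxor db T l'.neg) : Propagates M φxor db T l
  | xor (L : Finset (Lit V)) (l : Lit V) (hL : ∀ m ∈ L, Propagates M φxor db T m)
      (h : XorImplies M φxor ↑L l.toXor) : Propagates M φxor db T l

/-- Propagation from `T` leads to a conflict: a false clause of the database, a contradiction in
the xor module, or a pair of complementary literals. -/
def Conflicts (M : XorModule) (φxor : Finset (XorConstraint V)) (db : Finset (Clause V))
    (T : Set (Lit V)) : Prop :=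
  (∃ C ∈ db, ∀ l ∈ C, Propagates M φxor db T l.neg) ∨
  (∃ L : Finset (Lit V), (∀ m ∈ L, Propagates M φxor db T m) ∧
    XorImplies M φxor ↑L (XorConstraint.bot V)) ∨
  ∃ l, Propagates M φxor db T l ∧ Propagates M φxor db T l.neg

/-- The clause `C` is absorbed by the database: falsifying it leads to a conflict, and falsifying
all its literals but one leads to a conflict or makes propagation infer the remaining one. So
for propagation `C` is as good as a member of the database. -/
def Absorbed (M : XorModule) (φxor : Finset (XorConstraint V)) (db : Finset (Clause V))
    (C : Clause V) : Prop :=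
  Conflicts M φxor db (Clause.negs C) ∧
  ∀ l ∈ C, Propagates M φxor db (Clause.negs (C.erase l)) l ∨
    Conflicts M φxor db (Clause.negs (C.erase l))

variable {M : XorModule} {φxor : Finset (XorConstraint V)} {db db' : Finset (Clause V)}
  {T T' : Set (Lit V)} {C : Clause V} {l : Lit V}

theorem Propagates.trans (h : Propagates M φxor db T l) (hdb : db ⊆ db')
    (hT : ∀ m ∈ T, Propagates M φxor db' T' m) : Propagates M φxor db' T' l := by
  induction h with
  | base l h => exact hT l h
  | clause C l hC hl _ ih => exact .clause C l (hdb hC) hl ih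
  | xor L l _ h ih => exact .xor L l ih h

theorem Conflicts.trans (h : Conflicts M φxor db T) (hdb : db ⊆ db')
    (hT : ∀ m ∈ T, Propagates M φxor db' T' m) : Conflicts M φxor db' T' := by
  rcases h with ⟨C, hC, h⟩ | ⟨L, hL, h⟩ | ⟨l, h1, h2⟩
  · exact Or.inl ⟨C, hdb hC, fun l hl => (h l hl).trans hdb hT⟩
  · exact Or.inr (Or.inl ⟨L, fun m hm => (hL m hm).trans hdb hT, h⟩)
  · exact Or.inr (Or.inr ⟨l, h1.trans hdb hT, h2.trans hdb hT⟩)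

theorem Propagates.mono (h : Propagates M φxor db T l) (hdb : db ⊆ db') (hT : T ⊆ T') :
    Propagates M φxor db' T' l :=
  h.trans hdb fun m hm => .base m (hT hm)

theorem Conflicts.mono (h : Conflicts M φxor db T) (hdb : db ⊆ db') (hT : T ⊆ T') :
    Conflicts M φxor db' T' :=
  h.trans hdb fun m hm => .base m (hT hm)

theorem Absorbed.mono (h : Absorbed M φxor db C) (hdb : db ⊆ db') : Absorbed M φxor db' C :=
  ⟨h.1.mono hdb subset_rfl, fun l hl => (h.2 l hl).imp (fun h => h.mono hdb subset_rfl)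
    fun h => h.mono hdb subset_rfl⟩

theorem absorbed_of_mem (h : C ∈ db) : Absorbed M φxor db C :=
  ⟨Or.inl ⟨C, h, fun _ hl => .base _ (Clause.neg_mem_negs hl)⟩, fun l hl =>
    Or.inl (.clause C l h hl fun _ hl' hne => .base _
      (Clause.neg_mem_negs (Finset.mem_erase.2 ⟨hne, hl'⟩)))⟩

/-- Substituting the values of some of its variables into a constraint of `φxor`. -/
theorem XorImplies.exists_sdiff {D : XorConstraint V} (hD : D ∈ φxor) (τ : V → Bool)
    (X : Finset V) :
    X ⊆ D.vars → (∀ x ∈ X, (⟨x, τ x⟩ : Lit V) ∈ T) →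
      ∃ q, bit q = bit D.parity + ∑ x ∈ X, bit (τ x) ∧ XorImplies M φxor T ⟨D.vars \ X, q⟩ := by
  induction X using Finset.induction_on with
  | empty => exact fun _ _ => ⟨D.parity, by simp, .input _ (Or.inl (by simpa using hD))⟩
  | insert x X hx ih =>
    intro hX hT
    obtain ⟨q, hq, h⟩ := ih (fun y hy => hX (Finset.mem_insert_of_mem hy))
      fun y hy => hT y (Finset.mem_insert_of_mem hy)
    have hxD : x ∈ (⟨D.vars \ X, q⟩ : XorConstraint V).vars :=
      Finset.mem_sdiff.2 ⟨hX (Finset.mem_insert_self _ _), hx⟩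
    have hlit : XorImplies M φxor T ⟨{x}, τ x⟩ :=
      .input _ (Or.inr ⟨_, hT x (Finset.mem_insert_self _ _), rfl⟩)
    have hrule : M.Rule [⟨{x}, τ x⟩, ⟨D.vars \ X, q⟩]
        ((⟨D.vars \ X, q⟩ : XorConstraint V).subst x ∅ (τ x)) := by
      cases M with
      | subst =>
        cases τ x
        · exact SubstRule.unitNeg x _ hxD
        · exact SubstRule.unitPos x _ hxD
      | ec => exact ECRule.unit x _ _ hxD
    refine ⟨xor q (τ x), ?_, ?_⟩
    · rw [Finset.sum_insert hx, bit_xor, hq]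
      ring
    · have h1 := Derivable.rule _ _ hrule (ψ := ↑φxor ∪ Lit.toXor '' T) (by
        rintro E (_ | ⟨_, _ | ⟨_, hE⟩⟩)
        · exact hlit
        · exact h
        · cases hE)
      rw [XorConstraint.subst_empty hxD] at h1
      rwa [Finset.sdiff_insert]

theorem absorbed_of_mem_cnf {D : XorConstraint V} (hD : D ∈ φxor) (hC : C ∈ D.cnf) :
    Absorbed M φxor db C := by
  obtain ⟨τ, hτ, rfl⟩ := XorConstraint.mem_cnf_iff.1 hC
  have h2 : ∑ x ∈ D.vars, bit (τ x) = bit D.parity + 1 := by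
    have key : ∀ (a : ZMod 2) (b : Bool), a ≠ bit b → a = bit b + 1 := by decide
    exact key _ _ hτ
  constructor
  · obtain ⟨q, hq, h⟩ := XorImplies.exists_sdiff (M := M)
      (T := ↑(D.vars.image fun x => (⟨x, τ x⟩ : Lit V))) hD τ D.vars subset_rfl
      fun x hx => by simpa using hx
    refine Or.inr (Or.inl ⟨D.vars.image fun x => ⟨x, τ x⟩, fun m hm => ?_, ?_⟩)
    · obtain ⟨x, hx, rfl⟩ := Finset.mem_image.1 hm
      exact .base _ (Finset.mem_image.2 ⟨x, hx, rfl⟩)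
    · have hq' : q = true := by
        rw [h2] at hq
        revert hq
        exact (by decide : ∀ b c : Bool, bit c = bit b + (bit b + 1) → c = true) _ _
      rw [Finset.sdiff_self, hq'] at h
      exact h
  · intro l hl
    obtain ⟨x, hx, rfl⟩ := Finset.mem_image.1 hl
    obtain ⟨q, hq, h⟩ := XorImplies.exists_sdiff (M := M)
      (T := ↑((D.vars.erase x).image fun y => (⟨y, τ y⟩ : Lit V))) hD τ (D.vars.erase x)
      (Finset.erase_subset _ _) fun y hy => by simpa [and_comm] using hy
    refine Or.inl (.xor ((D.vars.erase x).image fun y => ⟨y, τ y⟩) _ (fun m hm => ?_) ?_)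
    · obtain ⟨y, hy, rfl⟩ := Finset.mem_image.1 hm
      obtain ⟨hyx, hy⟩ := Finset.mem_erase.1 hy
      refine .base _ (Finset.mem_erase.2 ⟨fun h => hyx (congrArg Lit.var h), ?_⟩)
      exact Finset.mem_image.2 ⟨y, hy, rfl⟩
    · have hq' : q = !τ x := by
        rw [← Finset.add_sum_erase _ _ hx] at h2
        revert hq h2
        generalize ∑ y ∈ D.vars.erase x, bit (τ y) = a
        exact (by decide : ∀ (a : ZMod 2) (b c d : Bool), bit d + a = bit b + 1 →
          bit c = bit b + a → c = !d) _ _ _ _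
      rw [Finset.sdiff_erase_self hx, hq'] at h
      exact h

theorem Absorbed.conflicts_resolvent {A B : Clause V} (hA : Absorbed M φxor db A)
    (hB : Absorbed M φxor db B) (hlA : l ∈ A) (hlB : l.neg ∈ B) :
    Conflicts M φxor db (Clause.negs (resolvent A B l)) := by
  have h1 : Clause.negs (A.erase l) ⊆ Clause.negs (resolvent A B l) :=
    Clause.negs_mono Finset.subset_union_left
  have h2 : Clause.negs (B.erase l.neg) ⊆ Clause.negs (resolvent A B l) :=
    Clause.negs_mono Finset.subset_union_right
  rcases hA.2 l hlA with hA | hA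
  · rcases hB.2 _ hlB with hB | hB
    · exact Or.inr (Or.inr ⟨l, hA.mono subset_rfl h1, hB.mono subset_rfl h2⟩)
    · exact hB.mono subset_rfl h2
  · exact hA.mono subset_rfl h1

end Propagation

/-! ### Runs of the eager solver -/

section Runs

variable {V : Type*} [DecidableEq V] {M : XorModule} {φ : CnfXor V} {eager : Bool}

theorem Run.trans {σ τ ρ : State V} {s s' : ℕ} (h : Run M φ eager σ s τ)
    (h' : Run M φ eager τ s' ρ) : Run M φ eager σ (s + s') ρ := by
  induction h with
  | refl σ => rwa [Nat.zero_add]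
  | step σ τ' τ k s h _ ih =>
    rw [Nat.add_assoc]
    exact .step _ _ _ _ _ h (ih h')

theorem Step.run {σ τ : State V} {k : ℕ} (h : Step M φ eager σ k τ) : Run M φ eager σ k τ :=
  .step _ _ _ _ _ h (.refl _)

/-- A trail as the solver builds it: every reason was unit when its literal was assigned, and
propagation infers the literal from the falsity of the other literals of the reason. -/
inductive GoodTrail (M : XorModule) (φ : CnfXor V) (db : Finset (Clause V)) : Trail V → Prop
  | nil : GoodTrail M φ db []
  | decide (l : Lit V) (t : Trail V) (ht : GoodTrail M φ db t) (hv : l.var ∈ φ.vars)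
      (hl : t.Unassigned l) : GoodTrail M φ db ((l, none) :: t)
  | imply (l : Lit V) (R : Clause V) (t : Trail V) (ht : GoodTrail M φ db t)
      (hv : l.var ∈ φ.vars) (hl : t.MakesUnit R l)
      (hR : Propagates M φ.xors db (Clause.negs (R.erase l)) l) :
      GoodTrail M φ db ((l, some R) :: t)

variable {db db' : Finset (Clause V)} {t p : Trail V} {K : Clause V} {l : Lit V}

theorem GoodTrail.mono (h : GoodTrail M φ db t) (hdb : db ⊆ db') : GoodTrail M φ db' t := by
  induction h with
  | nil => exact .nil
  | decide l t _ hv hl ih => exact .decide l t ih hv hl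
  | imply l R t _ hv hl hR ih => exact .imply l R t ih hv hl (hR.mono hdb subset_rfl)

theorem GoodTrail.of_cons {e : Lit V × Option (Clause V)} (h : GoodTrail M φ db (e :: t)) :
    GoodTrail M φ db t := by
  cases h with
  | decide _ _ ht _ _ => exact ht
  | imply _ _ _ ht _ _ _ => exact ht

theorem GoodTrail.of_append (h : GoodTrail M φ db (p ++ t)) : GoodTrail M φ db t := by
  induction p with
  | nil => exact h
  | cons e p ih => exact ih h.of_cons

theorem GoodTrail.consistent (h : GoodTrail M φ db t) : Consistent t.lits := by
  induction h with
  | nil => simp [Consistent]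
  | decide l t _ hv hl ih => exact hl.consistent_cons ih _
  | imply l R t _ hv hl hR ih => exact hl.2.1.consistent_cons ih _

theorem GoodTrail.var_mem (h : GoodTrail M φ db t) : ∀ m ∈ t.lits, m.var ∈ φ.vars := by
  induction h with
  | nil => simp
  | decide l t _ hv hl ih =>
    rw [Trail.lits_cons]
    rintro m (rfl | hm)
    exacts [hv, ih m hm]
  | imply l R t _ hv hl hR ih =>
    rw [Trail.lits_cons]
    rintro m (rfl | hm)
    exacts [hv, ih m hm]

theorem GoodTrail.length_le (h : GoodTrail M φ db t) : t.length ≤ φ.vars.card := by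
  have hnd : (t.map fun e => e.1.var).Nodup := by
    induction h with
    | nil => exact List.nodup_nil
    | decide l t _ hv hl ih => exact List.nodup_cons.2 ⟨hl.var_notMem, ih⟩
    | imply l R t _ hv hl hR ih => exact List.nodup_cons.2 ⟨hl.2.1.var_notMem, ih⟩
  rw [← List.length_map (fun e => e.1.var), ← List.toFinset_card_of_nodup hnd]
  refine Finset.card_le_card fun x hx => ?_
  obtain ⟨e, he, rfl⟩ := List.mem_map.1 (List.mem_toFinset.1 hx)
  exact h.var_mem _ (List.mem_map.2 ⟨e, he, rfl⟩)

theorem GoodTrail.propagates_append (h : GoodTrail M φ db (p ++ t)) (hp : p.DecisionFree) :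
    ∀ m ∈ Trail.lits (p ++ t), Propagates M φ.xors db t.lits m := by
  induction p with
  | nil => exact fun m hm => .base m hm
  | cons e p ih =>
    have ih := ih h.of_cons fun e he => hp e (List.mem_cons_of_mem _ he)
    rw [List.cons_append, Trail.lits_cons]
    rintro m (rfl | hm)
    · cases h with
      | decide l _ _ _ _ => exact absurd rfl (hp _ List.mem_cons_self)
      | imply l R _ _ hv hl hR =>
        refine hR.trans subset_rfl fun m hm => ih m ?_
        obtain ⟨hne, hm⟩ := Finset.mem_erase.1 hm
        simpa using hl.2.2 _ hm hne
    · exact ih m hm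

theorem Trail.coe_lits_toFinset (t : Trail V) :
    (↑(t.map Prod.fst).toFinset : Set (Lit V)) = t.lits := by
  ext l
  simp [Trail.lits]

theorem CnfXor.vars_subset_of_mem_xors {D : XorConstraint V} (h : D ∈ φ.xors) :
    D.vars ⊆ φ.vars := fun _ hx =>
  Finset.mem_union_right _ (Finset.mem_biUnion.2 ⟨D, h, hx⟩)

/-- A literal derivable by the xor module that is not true on the trail can be reported with a
small derivation. -/
theorem GoodTrail.exists_reports (h : GoodTrail M φ db t) {b : ℕ} (hb : 1 ≤ b)
    (hφ : φ.XorWidthLE b) {L : Finset (Lit V)} (hL : ∀ m ∈ L, m ∈ t.lits)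
    (hl : XorImplies M φ.xors ↑L l.toXor) (hlt : l ∉ t.lits) :
    ∃ L : Finset (Lit V), (∀ m ∈ L, m ∈ t.lits) ∧ XorImplies M φ.xors ↑L l.toXor ∧
      ∃ k ≤ reportBound b φ.vars.card, Reports M φ.xors t.lits (insert l (L.image Lit.neg)) k := by
  have hA := t.coe_lits_toFinset
  obtain ⟨L', hL', himp, k, hk, hr⟩ := exists_reports_of_xorImplies (A := (t.map Prod.fst).toFinset)
    (f := fun L => insert l (L.image Lit.neg)) (Z := φ.vars) (hl.mono (hA ▸ hL))
    (fun hmem => by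
      obtain ⟨a, ha, hal⟩ := Finset.mem_image.1 hmem
      rw [Lit.toXor_injective hal, ← Finset.mem_coe, hA] at ha
      exact hlt ha) hb hφ (fun E hE => CnfXor.vars_subset_of_mem_xors hE)
    (fun a ha => h.var_mem a (by rwa [← hA])) (fun L => Or.inl ⟨l, rfl, rfl⟩)
  rw [hA] at hr
  exact ⟨L', fun m hm => by rw [← hA]; exact hL' hm, himp, k, hk, hr⟩

theorem GoodTrail.exists_reports_bot (h : GoodTrail M φ db t) {b : ℕ} (hb : 1 ≤ b)
    (hφ : φ.XorWidthLE b) {L : Finset (Lit V)} (hL : ∀ m ∈ L, m ∈ t.lits)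
    (hl : XorImplies M φ.xors ↑L (XorConstraint.bot V)) :
    ∃ L : Finset (Lit V), (∀ m ∈ L, m ∈ t.lits) ∧
      XorImplies M φ.xors ↑L (XorConstraint.bot V) ∧
      ∃ k ≤ reportBound b φ.vars.card, Reports M φ.xors t.lits (L.image Lit.neg) k := by
  have hA := t.coe_lits_toFinset
  obtain ⟨L', hL', himp, k, hk, hr⟩ := exists_reports_of_xorImplies (A := (t.map Prod.fst).toFinset)
    (f := fun L => L.image Lit.neg) (Z := φ.vars) (hl.mono (hA ▸ hL))
    (fun hmem => by
      obtain ⟨a, -, hal⟩ := Finset.mem_image.1 hmem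
      exact a.toXor_ne_bot hal) hb hφ (fun E hE => CnfXor.vars_subset_of_mem_xors hE)
    (fun a ha => h.var_mem a (by rwa [← hA])) (fun L => Or.inr ⟨rfl, rfl⟩)
  rw [hA] at hr
  exact ⟨L', fun m hm => by rw [← hA]; exact hL' hm, himp, k, hk, hr⟩

theorem Trail.falsifies_image_neg {L : Finset (Lit V)} (hL : ∀ m ∈ L, m ∈ t.lits) :
    t.Falsifies (L.image Lit.neg) := fun m hm => by
  obtain ⟨a, ha, rfl⟩ := Finset.mem_image.1 hm
  simpa using hL a ha

theorem Trail.falsifies_insert {C : Clause V} (hl : l.neg ∈ t.lits) (hC : t.Falsifies C) :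
    t.Falsifies (insert l C) := fun m hm => by
  rcases Finset.mem_insert.1 hm with rfl | hm
  exacts [hl, hC m hm]

theorem Trail.makesUnit_insert {C : Clause V} (hl : t.Unassigned l) (hC : t.Falsifies C) :
    t.MakesUnit (insert l C) l :=
  ⟨Finset.mem_insert_self _ _, hl, fun m hm hne =>
    hC m ((Finset.mem_insert.1 hm).resolve_left hne)⟩

/-- A saturated trail is closed under propagation. -/
theorem Saturated.mem_lits (hs : Saturated M φ t db) (h : GoodTrail M φ db t)
    {b : ℕ} (hb : 1 ≤ b) (hφ : φ.XorWidthLE b) (hl : Propagates M φ.xors db t.lits l) :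
    l ∈ t.lits := by
  induction hl with
  | base l h => exact h
  | clause C l hC hl _ ih =>
    by_contra hlt
    by_cases hln : l.neg ∈ t.lits
    · refine (hs C (Or.inl hC)).1 fun m hm => ?_
      by_cases hml : m = l
      · exact hml ▸ hln
      · exact ih m hm hml
    · exact (hs C (Or.inl hC)).2 l ⟨hl, ⟨hlt, hln⟩, ih⟩
  | xor L l _ hl ih =>
    by_contra hlt
    obtain ⟨L', hL', -, k, -, hr⟩ := h.exists_reports hb hφ ih hl hlt
    have hf := Trail.falsifies_image_neg hL'
    by_cases hln : l.neg ∈ t.lits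
    · exact (hs _ (Or.inr ⟨k, hr⟩)).1 (Trail.falsifies_insert hln hf)
    · exact (hs _ (Or.inr ⟨k, hr⟩)).2 l (Trail.makesUnit_insert ⟨hlt, hln⟩ hf)

theorem Saturated.not_conflicts (hs : Saturated M φ t db) (h : GoodTrail M φ db t)
    {b : ℕ} (hb : 1 ≤ b) (hφ : φ.XorWidthLE b) : ¬ Conflicts M φ.xors db t.lits := by
  rintro (⟨C, hC, hf⟩ | ⟨L, hL, hbot⟩ | ⟨l, h1, h2⟩)
  · exact (hs C (Or.inl hC)).1 fun m hm => hs.mem_lits h hb hφ (hf m hm)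
  · obtain ⟨L', hL', -, k, -, hr⟩ := h.exists_reports_bot hb hφ
      (fun m hm => hs.mem_lits h hb hφ (hL m hm)) hbot
    exact (hs _ (Or.inr ⟨k, hr⟩)).1 (Trail.falsifies_image_neg hL')
  · exact h.consistent l (hs.mem_lits h hb hφ h1) (hs.mem_lits h hb hφ h2)

/-- All variables of the database occur in the formula. -/
def GoodDb (φ : CnfXor V) (db : Finset (Clause V)) : Prop :=
  ∀ C ∈ db, ∀ l ∈ C, l.var ∈ φ.vars

/-- When propagation is not complete, the solver can assign a literal or start conflict analysis
at a bounded cost. -/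
theorem GoodTrail.progress (h : GoodTrail M φ db t) (hdb : GoodDb φ db) {b : ℕ} (hb : 1 ≤ b)
    (hφ : φ.XorWidthLE b) (hs : ¬ Saturated M φ t db) :
    (∃ l R, ∃ k ≤ reportBound b φ.vars.card + 1,
      Step M φ eager (.search t db) k (.search ((l, some R) :: t) db) ∧
      GoodTrail M φ db ((l, some R) :: t)) ∨
    ∃ K, ∃ k ≤ reportBound b φ.vars.card + 1,
      Step M φ eager (.search t db) k (.analyze t db K) ∧ t.Falsifies K ∧
      Conflicts M φ.xors db (Clause.negs K) := by
  -- a literal derived by the xor module is assigned if possible, and otherwise starts a conflict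
  have hlit : ∀ (L : Finset (Lit V)) (l : Lit V), (∀ m ∈ L, m ∈ t.lits) →
      XorImplies M φ.xors ↑L l.toXor → l ∉ t.lits → (∃ l R, ∃ k ≤ reportBound b φ.vars.card + 1,
        Step M φ eager (.search t db) k (.search ((l, some R) :: t) db) ∧
        GoodTrail M φ db ((l, some R) :: t)) ∨
      ∃ K, ∃ k ≤ reportBound b φ.vars.card + 1,
        Step M φ eager (.search t db) k (.analyze t db K) ∧ t.Falsifies K ∧
        Conflicts M φ.xors db (Clause.negs K) := by
    intro L l hL hl hlt
    obtain ⟨L', hL', himp, k, hk, hr⟩ := h.exists_reports hb hφ hL hl hlt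
    have hf := Trail.falsifies_image_neg hL'
    by_cases hln : l.neg ∈ t.lits
    · refine Or.inr ⟨_, 1 + k, by omega, .xorConflict t db _ k hr (Trail.falsifies_insert hln hf),
        Trail.falsifies_insert hln hf, Or.inr (Or.inr ⟨l, .xor L' l (fun m hm => ?_) himp, ?_⟩)⟩
      · exact .base _ (Finset.mem_insert_of_mem (Finset.mem_image_of_mem _ hm))
      · exact .base _ (Clause.neg_mem_negs (Finset.mem_insert_self _ _))
    · have hu := Trail.makesUnit_insert ⟨hlt, hln⟩ hf
      refine Or.inl ⟨l, _, 1 + k, by omega, .xorPropagate t db _ l k hr hu, .imply l _ t h ?_ hu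
        (.xor L' l (fun m hm => .base _ (Finset.mem_erase.2 ⟨?_, ?_⟩)) himp)⟩
      · have hsub := Derivable.vars_subset himp (Z := φ.vars) (by
          rintro E (hE | ⟨a, ha, rfl⟩)
          · exact CnfXor.vars_subset_of_mem_xors hE
          · exact Finset.singleton_subset_iff.2 (h.var_mem a (hL' a ha)))
        exact hsub (Finset.mem_singleton_self _)
      · rintro rfl
        exact hln (by simpa using hL' m hm)
      · exact Finset.mem_insert_of_mem (Finset.mem_image_of_mem _ hm)
  unfold Saturated at hs
  push Not at hs
  obtain ⟨C, hC, hCt⟩ := hs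
  rcases hC with hC | ⟨k, hC⟩
  · by_cases hf : t.Falsifies C
    · exact Or.inr ⟨C, 1, by omega, .conflict t db C hC hf, hf, (absorbed_of_mem hC).1⟩
    · obtain ⟨l, hl⟩ := hCt hf
      refine Or.inl ⟨l, C, 1, by omega, .propagate t db C l hC hl,
        .imply l C t h (hdb C hC l hl.1) hl (.clause C l hC hl.1 fun m hm hne => ?_)⟩
      exact .base _ (Clause.neg_mem_negs (Finset.mem_erase.2 ⟨hne, hm⟩))
  · obtain ⟨L, hL, ⟨l, himp, rfl⟩ | ⟨himp, -⟩⟩ := hC.exists_xorImplies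
    · refine hlit L l hL himp fun hlt => ?_
      by_cases hf : t.Falsifies (insert l (L.image Lit.neg))
      · exact h.consistent l hlt (hf l (Finset.mem_insert_self _ _))
      · obtain ⟨m, hm, hmu, -⟩ := hCt hf
        rcases Finset.mem_insert.1 hm with rfl | hm
        · exact hmu.1 hlt
        · exact hmu.2 (Trail.falsifies_image_neg hL m hm)
    · obtain ⟨L', hL', himp, k, hk, hr⟩ := h.exists_reports_bot hb hφ hL himp
      have hf := Trail.falsifies_image_neg hL'
      refine Or.inr ⟨_, 1 + k, by omega, .xorConflict t db _ k hr hf, hf,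
        Or.inr (Or.inl ⟨L', fun m hm => .base _ ?_, himp⟩)⟩
      exact Finset.mem_image_of_mem _ hm

/-- Propagation runs until it is complete or a conflict arises. -/
theorem GoodTrail.exists_saturate (h : GoodTrail M φ db t) (hdb : GoodDb φ db) {b : ℕ}
    (hb : 1 ≤ b) (hφ : φ.XorWidthLE b) :
    ∃ (p : Trail V) (s : ℕ), p.DecisionFree ∧ GoodTrail M φ db (p ++ t) ∧
      s ≤ (p.length + 1) * (reportBound b φ.vars.card + 1) ∧
      ((Saturated M φ (p ++ t) db ∧ Run M φ eager (.search t db) s (.search (p ++ t) db)) ∨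
        ∃ K, Run M φ eager (.search t db) s (.analyze (p ++ t) db K) ∧
          Trail.Falsifies (p ++ t) K ∧ Conflicts M φ.xors db (Clause.negs K)) := by
  induction hn : φ.vars.card - t.length using Nat.strong_induction_on generalizing t with
  | _ n ih =>
    by_cases hs : Saturated M φ t db
    · exact ⟨[], 0, by simp [Trail.DecisionFree], h, Nat.zero_le _, Or.inl ⟨hs, .refl _⟩⟩
    rcases h.progress (eager := eager) hdb hb hφ hs with
      ⟨l, R, k, hk, hstep, ht⟩ | ⟨K, k, hk, hstep, hf, hK⟩
    · have hlen := ht.length_le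
      rw [List.length_cons] at hlen
      obtain ⟨p, s, hp, hpt, hsb, hrun⟩ := ih (φ.vars.card - ((l, some R) :: t : Trail V).length)
        (by rw [List.length_cons]; omega) ht rfl
      rw [List.append_cons] at hpt hrun
      refine ⟨p ++ [(l, some R)], k + s, fun e he => ?_, hpt, ?_, ?_⟩
      · rcases List.mem_append.1 he with he | he
        · exact hp e he
        · rw [List.mem_singleton.1 he]
          exact Option.some_ne_none R
      · rw [List.length_append, List.length_singleton, Nat.succ_mul]
        omega
      · exact hrun.imp (fun h => ⟨h.1, hstep.run.trans h.2⟩)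
          fun ⟨K, h1, h2⟩ => ⟨K, hstep.run.trans h1, h2⟩
    · exact ⟨[], k, by simp [Trail.DecisionFree], h, by simpa using hk,
        Or.inr ⟨K, hstep.run, hf, hK⟩⟩

end Runs

/-! ### Learning clauses -/

section Learning

variable {V : Type*} [DecidableEq V] {M : XorModule} {φ : CnfXor V} {eager : Bool}
  {db db' : Finset (Clause V)} {t t' p : Trail V} {C K : Clause V} {l : Lit V} {b : ℕ}

/-- Conflict analysis back to a given point of the trail. The conflict clause stays false on the
trail, and falsifying it leads propagation to a conflict. -/
theorem GoodTrail.exists_analyze (h : GoodTrail M φ db (p ++ t)) (hp : p.DecisionFree)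
    (hf : Trail.Falsifies (p ++ t) K) (hK : Conflicts M φ.xors db (Clause.negs K)) :
    ∃ K', Run M φ eager (.analyze (p ++ t) db K) p.length (.analyze t db K') ∧
      t.Falsifies K' ∧ Conflicts M φ.xors db (Clause.negs K') := by
  induction p generalizing K with
  | nil => exact ⟨K, .refl _, hf, hK⟩
  | cons e p ih =>
    obtain ⟨l, r⟩ := e
    have hp' : Trail.DecisionFree p := fun e he => hp e (List.mem_cons_of_mem _ he)
    -- literals of the clause other than the negation of `l` are false on the rest of the trail
    have hrest : ∀ m ∈ K, m ≠ l.neg → m.neg ∈ Trail.lits (p ++ t) := fun m hm hne => by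
      have := hf m hm
      rw [List.cons_append, Trail.lits_cons] at this
      exact this.resolve_left fun h : m.neg = l => hne (by rw [← h, Lit.neg_neg])
    have hK' : ∃ K', Step M φ eager (.analyze ((l, r) :: p ++ t) db K) 1
        (.analyze (p ++ t) db K') ∧ Trail.Falsifies (p ++ t) K' ∧
        Conflicts M φ.xors db (Clause.negs K') := by
      by_cases hl : l.neg ∈ K
      · cases h with
        | decide => exact absurd rfl (hp _ List.mem_cons_self)
        | imply l R _ ht hv hu hR =>
          refine ⟨_, .resolve _ _ _ _ _ hl, fun m hm => ?_, hK.trans subset_rfl fun m hm => ?_⟩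
          · rcases Finset.mem_union.1 hm with hm | hm <;> obtain ⟨hne, hm⟩ := Finset.mem_erase.1 hm
            · exact hu.2.2 m hm hne
            · exact hrest m hm hne
          · by_cases hml : m = l
            · rw [hml]
              exact hR.mono subset_rfl (Clause.negs_mono Finset.subset_union_left)
            · refine .base _ (Finset.mem_union_right _ (Finset.mem_erase.2 ⟨fun h => ?_, hm⟩))
              exact hml (Lit.neg_injective h)
      · exact ⟨K, .skip _ _ _ _ _ hl, fun m hm => hrest m hm fun h => hl (h ▸ hm), hK⟩
    obtain ⟨K', hstep, hf', hK'⟩ := hK'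
    obtain ⟨K'', hrun, h''⟩ := ih h.of_cons hp' hf' hK'
    refine ⟨K'', ?_, h''⟩
    rw [List.length_cons, Nat.add_comm]
    exact hstep.run.trans hrun

/-- Literals of a set without conflict can be decided one after the other, with complete
propagation in between, until all of them are true. -/
theorem GoodTrail.exists_decide (hdb : GoodDb φ db) (hb : 1 ≤ b) (hφ : φ.XorWidthLE b)
    {T : Set (Lit V)} (hT : ¬ Conflicts M φ.xors db T) (D : List (Lit V))
    (hD : ∀ m ∈ D, m ∈ T ∧ m.var ∈ φ.vars) (h : GoodTrail M φ db t) (hs : Saturated M φ t db)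
    (htT : ∀ m ∈ t.lits, Propagates M φ.xors db T m) :
    ∃ (p : Trail V) (s : ℕ), s ≤ p.length * (reportBound b φ.vars.card + 2) ∧
      GoodTrail M φ db (p ++ t) ∧ Saturated M φ (p ++ t) db ∧
      (∀ m ∈ D, m ∈ Trail.lits (p ++ t)) ∧
      (∀ m ∈ Trail.lits (p ++ t), Propagates M φ.xors db T m) ∧
      Run M φ eager (.search t db) s (.search (p ++ t) db) := by
  induction D generalizing t with
  | nil => exact ⟨[], 0, by simp, h, hs, by simp, htT, .refl _⟩
  | cons m D ih =>
    have hD' : ∀ m ∈ D, m ∈ T ∧ m.var ∈ φ.vars := fun m hm => hD m (List.mem_cons_of_mem _ hm)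
    obtain ⟨hmT, hmv⟩ := hD m List.mem_cons_self
    by_cases hmt : m ∈ t.lits
    · obtain ⟨p, s, h1, h2, h3, h4, h5, h6⟩ := ih hD' h hs htT
      refine ⟨p, s, h1, h2, h3, ?_, h5, h6⟩
      rintro a (_ | ⟨_, ha⟩)
      · rw [Trail.lits_append]
        exact Or.inr hmt
      · exact h4 a ha
    have hmn : m.neg ∉ t.lits := fun hmn => hT (Or.inr (Or.inr ⟨m, .base m hmT, htT _ hmn⟩))
    have ht₁ : GoodTrail M φ db ((m, none) :: t) := .decide m t h hmv ⟨hmt, hmn⟩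
    have htT₁ : ∀ a ∈ Trail.lits ((m, none) :: t), Propagates M φ.xors db T a := by
      rw [Trail.lits_cons]
      rintro a (rfl | ha)
      exacts [.base _ hmT, htT a ha]
    obtain ⟨p₁, s₁, hp₁, hg₁, hs₁, hr₁⟩ := ht₁.exists_saturate (eager := eager) hdb hb hφ
    have hprop : ∀ a ∈ Trail.lits (p₁ ++ (m, none) :: t), Propagates M φ.xors db T a := fun a ha =>
      (hg₁.propagates_append hp₁ a ha).trans subset_rfl htT₁
    rcases hr₁ with ⟨hsat, hr₁⟩ | ⟨K, -, hf, hK⟩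
    · obtain ⟨p, s, h1, h2, h3, h4, h5, h6⟩ := ih hD' hg₁ hsat hprop
      have hpt : p ++ (p₁ ++ (m, none) :: t) = (p ++ (p₁ ++ [(m, none)])) ++ t := by simp
      have hm : m ∈ Trail.lits (p ++ (p₁ ++ (m, none) :: t)) := by simp [Trail.lits_append]
      rw [hpt] at h2 h3 h4 h5 h6 hm
      refine ⟨_, 1 + (s₁ + s), ?_, h2, h3, ?_, h5,
        (Step.run (.decide t db m hmv ⟨hmt, hmn⟩ fun _ => hs)).trans (hr₁.trans h6)⟩
      · simp only [List.length_append, List.length_singleton]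
        calc 1 + (s₁ + s) ≤ 1 + ((p₁.length + 1) * (reportBound b φ.vars.card + 1) +
              p.length * (reportBound b φ.vars.card + 2)) := by omega
          _ ≤ (p.length + (p₁.length + 1)) * (reportBound b φ.vars.card + 2) := by nlinarith
      · rintro a (_ | ⟨_, ha⟩)
        · exact hm
        · exact h4 a ha
    · exact absurd (hK.trans subset_rfl fun a ha => hprop a (hf.negs_subset ha)) hT

theorem GoodTrail.exists_restart (h : GoodTrail M φ db t) :
    ∃ t', GoodTrail M φ db t' ∧ t'.DecisionFree ∧ ∃ s ≤ 1,
      Run M φ eager (.search t db) s (.search t' db) := by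
  rcases t.decisionFree_or_exists_eq_append with hf | ⟨p, d, t', rfl, hf⟩
  · exact ⟨t, h, hf, 0, Nat.zero_le _, .refl _⟩
  · rw [List.append_cons] at h
    exact ⟨t', h.of_append, hf, 1, le_rfl, Step.run (.restart t' p db d hf)⟩

/-- A bound on the cost of learning one clause, for formulas with `n` variables and constraints with
at most `b` variables. -/
def learnBound (b n : ℕ) : ℕ := (n + 2) * (reportBound b n + 3)

/-- A search state at which no decision is pending and whose trail and database are as the solver
builds them. -/
structure Ready (M : XorModule) (φ : CnfXor V) (t : Trail V) (db : Finset (Clause V)) : Prop where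
  trail : GoodTrail M φ db t
  decisionFree : t.DecisionFree
  db : GoodDb φ db

/-- From the search state with trail `t` and database `db`, the solver reaches without pending
decisions, at cost at most `s`, a larger database that satisfies `P`. -/
def Reaches (M : XorModule) (φ : CnfXor V) (eager : Bool) (t : Trail V) (db : Finset (Clause V))
    (s : ℕ) (P : Finset (Clause V) → Prop) : Prop :=
  ∃ t' db' s', s' ≤ s ∧ Ready M φ t' db' ∧ db ⊆ db' ∧ P db' ∧
    Run M φ eager (.search t db) s' (.search t' db')

/-- If falsifying `C` leads to a conflict, the solver can make propagation infer any given literal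
`l` of `C` from the falsity of the others: it decides the negations of the other literals, then
that of `l`, and learns the clause obtained by conflict analysis back to the last decision. -/
theorem Ready.reaches_propagates (h : Ready M φ t db) (hb : 1 ≤ b) (hφ : φ.XorWidthLE b)
    (hl : l ∈ C) (hCv : ∀ m ∈ C, m.var ∈ φ.vars) (hC : Conflicts M φ.xors db (Clause.negs C)) :
    Reaches M φ eager t db (learnBound b φ.vars.card) fun db' =>
      Propagates M φ.xors db' (Clause.negs (C.erase l)) l ∨
        Conflicts M φ.xors db' (Clause.negs (C.erase l)) := by
  by_cases h0 : Propagates M φ.xors db (Clause.negs (C.erase l)) l ∨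
    Conflicts M φ.xors db (Clause.negs (C.erase l))
  · exact ⟨t, db, 0, Nat.zero_le _, h, subset_rfl, h0, .refl _⟩
  obtain ⟨hnp, hnc⟩ := not_or.1 h0
  have hempty : ∀ m ∈ t.lits, Propagates M φ.xors db (Clause.negs (C.erase l)) m := fun m hm => by
    have h1 : GoodTrail M φ db (t ++ []) := by simpa using h.trail
    exact (h1.propagates_append h.decisionFree m (by simpa using hm)).trans subset_rfl (by simp)
  -- propagation before the first decision
  obtain ⟨p₁, s₁, hp₁, hg₁, hs₁, hr₁⟩ := h.trail.exists_saturate (eager := eager) h.db hb hφ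
  have hprop₁ : ∀ m ∈ Trail.lits (p₁ ++ t), Propagates M φ.xors db (Clause.negs (C.erase l)) m :=
    fun m hm => (hg₁.propagates_append hp₁ m hm).trans subset_rfl hempty
  obtain ⟨hsat₁, hr₁⟩ := hr₁.resolve_right fun ⟨K, _, hf, hK⟩ =>
    hnc (hK.trans subset_rfl fun m hm => hprop₁ m (hf.negs_subset hm))
  -- the other literals of `C` are made false
  obtain ⟨p₂, s₂, hs₂, hg₂, hsat₂, hmem₂, hprop₂, hr₂⟩ :=
    GoodTrail.exists_decide (eager := eager) h.db hb hφ hnc ((C.erase l).toList.map Lit.neg)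
      (fun m hm => by
        obtain ⟨a, ha, rfl⟩ := List.mem_map.1 hm
        have ha := Finset.mem_toList.1 ha
        exact ⟨Clause.neg_mem_negs ha, hCv a (Finset.mem_of_mem_erase ha)⟩) hg₁ hsat₁ hprop₁
  set t₂ := p₂ ++ (p₁ ++ t) with ht₂
  have hnc₂ := hsat₂.not_conflicts hg₂ hb hφ
  have hfalse : ∀ m ∈ C, m ≠ l → m.neg ∈ t₂.lits := fun m hm hne =>
    hmem₂ _ (List.mem_map.2 ⟨m, Finset.mem_toList.2 (Finset.mem_erase.2 ⟨hne, hm⟩), rfl⟩)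
  have hlt : l ∉ t₂.lits := fun hlt => hnp (hprop₂ l hlt)
  have hnegs : ∀ T : Set (Lit V), l.neg ∈ T → t₂.lits ⊆ T → Clause.negs C ⊆ T :=
    fun T hlT hT m hm => by
      by_cases hml : m.neg = l
      · rwa [← hml, Lit.neg_neg] at hlT
      · exact hT (by simpa using hfalse _ hm hml)
  have hln : l.neg ∉ t₂.lits := fun hln =>
    hnc₂ (hC.mono subset_rfl (hnegs _ hln subset_rfl))
  -- deciding the negation of `l` now leads to a conflict
  have hun : t₂.Unassigned l.neg := ⟨hln, by rwa [Lit.neg_neg]⟩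
  have hg₃ : GoodTrail M φ db ((l.neg, none) :: t₂) := .decide _ _ hg₂ (hCv l hl) hun
  obtain ⟨p₄, s₄, hp₄, hg₄, hs₄, hr₄⟩ := hg₃.exists_saturate (eager := eager) h.db hb hφ
  rcases hr₄ with ⟨hsat₄, -⟩ | ⟨K, hr₄, hfK, hK⟩
  · refine absurd (hC.mono subset_rfl (hnegs _ ?_ ?_)) (hsat₄.not_conflicts hg₄ hb hφ)
    · simp [Trail.lits_append]
    · rw [Trail.lits_append p₄, Trail.lits_cons]
      exact (Set.subset_insert _ _).trans Set.subset_union_right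
  obtain ⟨K', hr₅, hfK', hK'⟩ := hg₄.exists_analyze (eager := eager) hp₄ hfK hK
  have hfK₂ : ∀ m ∈ K', m ≠ l → m.neg ∈ t₂.lits := fun m hm hne => by
    have := hfK' m hm
    rw [Trail.lits_cons] at this
    exact this.resolve_left fun h => hne (Lit.neg_injective h)
  have hlK' : l ∈ K' := by
    by_contra hlK'
    refine hnc₂ (hK'.mono subset_rfl fun m hm => ?_)
    simpa using hfK₂ _ hm fun h => hlK' (h ▸ hm)
  have hlearn : Step M φ eager (.analyze ((l.neg, none) :: t₂) db K') 1
      (.search t₂ (insert K' db)) :=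
    .learn t₂ t₂ [] db K' l.neg l.neg none (by rwa [Lit.neg_neg]) rfl
      fun m hm hne => hfK₂ m hm (by rwa [Lit.neg_neg] at hne)
  obtain ⟨t', hg', hf', s', hs', hr'⟩ :=
    (hg₂.mono (Finset.subset_insert K' db)).exists_restart (eager := eager)
  refine ⟨t', insert K' db, s₁ + (s₂ + (1 + (s₄ + (p₄.length + (1 + s'))))), ?_,
    ⟨hg', hf', fun A hA m hm => ?_⟩, Finset.subset_insert _ _, Or.inl ?_, ?_⟩
  · have hlen := hg₄.length_le
    simp only [ht₂, List.length_append, List.length_cons] at hlen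
    rw [learnBound]
    generalize reportBound b φ.vars.card = B at *
    generalize φ.vars.card = n at *
    calc _ ≤ (p₁.length + 1) * (B + 1) + (p₂.length * (B + 2) + (1 + ((p₄.length + 1) * (B + 1) +
          (p₄.length + (1 + 1))))) := by omega
      _ ≤ (p₁.length + p₂.length + p₄.length + 3) * (B + 3) := by nlinarith
      _ ≤ (n + 2) * (B + 3) := Nat.mul_le_mul_right _ (by omega)
  · rcases Finset.mem_insert.1 hA with rfl | hA
    · exact hg₃.var_mem m.neg (hfK' m hm)
    · exact h.db A hA m hm
  · refine .clause K' l (Finset.mem_insert_self _ _) hlK' fun m hm hne => ?_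
    exact (hprop₂ _ (hfK₂ m hm hne)).mono (Finset.subset_insert _ _) subset_rfl
  · exact hr₁.trans (hr₂.trans ((Step.run (.decide _ db l.neg (hCv l hl) hun fun _ => hsat₂)).trans
      (hr₄.trans (hr₅.trans (hlearn.run.trans hr')))))

theorem Reaches.trans {s s' : ℕ} {P Q : Finset (Clause V) → Prop}
    (h : Reaches M φ eager t db s P)
    (h' : ∀ t' db', Ready M φ t' db' → db ⊆ db' → P db' → Reaches M φ eager t' db' s' Q) :
    Reaches M φ eager t db (s + s') Q := by
  obtain ⟨t₁, db₁, s₁, hs₁, hr₁, hdb₁, hP, hrun₁⟩ := h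
  obtain ⟨t₂, db₂, s₂, hs₂, hr₂, hdb₂, hQ, hrun₂⟩ := h' t₁ db₁ hr₁ hdb₁ hP
  exact ⟨t₂, db₂, s₁ + s₂, Nat.add_le_add hs₁ hs₂, hr₂, hdb₁.trans hdb₂, hQ, hrun₁.trans hrun₂⟩

/-- Learning one clause for each literal of `C` makes `C` absorbed. -/
theorem Ready.reaches_absorbed (h : Ready M φ t db) (hb : 1 ≤ b) (hφ : φ.XorWidthLE b)
    (hCv : ∀ m ∈ C, m.var ∈ φ.vars) (hC : Conflicts M φ.xors db (Clause.negs C)) :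
    Reaches M φ eager t db (2 * φ.vars.card * learnBound b φ.vars.card) fun db' =>
      Absorbed M φ.xors db' C := by
  have key : ∀ S ⊆ C, Reaches M φ eager t db (S.card * learnBound b φ.vars.card) fun db' =>
      ∀ l ∈ S, Propagates M φ.xors db' (Clause.negs (C.erase l)) l ∨
        Conflicts M φ.xors db' (Clause.negs (C.erase l)) := by
    intro S
    induction S using Finset.induction_on with
    | empty =>
      exact fun _ => ⟨t, db, 0, Nat.zero_le _, h, subset_rfl, by simp, .refl _⟩
    | insert l S hlS ih =>
      intro hS
      rw [Finset.card_insert_of_notMem hlS, Nat.succ_mul]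
      refine (ih ((Finset.subset_insert _ _).trans hS)).trans fun t₁ db₁ hr₁ hdb₁ hP₁ => ?_
      obtain ⟨t₂, db₂, s₂, hs₂, hr₂, hdb₂, hP₂, hrun₂⟩ := hr₁.reaches_propagates (eager := eager)
        hb hφ (hS (Finset.mem_insert_self _ _)) hCv (hC.mono hdb₁ subset_rfl)
      refine ⟨t₂, db₂, s₂, hs₂, hr₂, hdb₂, fun m hm => ?_, hrun₂⟩
      rcases Finset.mem_insert.1 hm with rfl | hm
      · exact hP₂
      · exact (hP₁ m hm).imp (fun h => h.mono hdb₂ subset_rfl) fun h => h.mono hdb₂ subset_rfl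
  obtain ⟨t', db', s, hs, hr, hdb, hP, hrun⟩ := key C subset_rfl
  refine ⟨t', db', s, hs.trans (Nat.mul_le_mul_right _ ?_), hr, hdb,
    ⟨hC.mono hdb subset_rfl, hP⟩, hrun⟩
  have h1 : C ⊆ (φ.vars ×ˢ (Finset.univ : Finset Bool)).image fun a => ⟨a.1, a.2⟩ := fun m hm =>
    Finset.mem_image.2 ⟨(m.var, m.sign), Finset.mem_product.2 ⟨hCv m hm, Finset.mem_univ _⟩, rfl⟩
  have h2 := (Finset.card_le_card h1).trans Finset.card_image_le
  rw [Finset.card_product, Finset.card_univ, Fintype.card_bool] at h2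
  omega

theorem CnfXor.var_mem_of_mem_toCnf (hC : C ∈ φ.toCnf) : ∀ m ∈ C, m.var ∈ φ.vars := fun m hm => by
  rcases Finset.mem_union.1 hC with hC | hC
  · exact Finset.mem_union_left _ (Finset.mem_biUnion.2 ⟨C, hC, Finset.mem_image_of_mem _ hm⟩)
  · obtain ⟨D, hD, hC⟩ := Finset.mem_biUnion.1 hC
    obtain ⟨τ, -, rfl⟩ := XorConstraint.mem_cnf_iff.1 hC
    obtain ⟨x, hx, rfl⟩ := Finset.mem_image.1 hm
    exact CnfXor.vars_subset_of_mem_xors hD hx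

/-- The clauses of a resolution derivation can be absorbed one after the other. -/
theorem IsResolutionDerivation.reaches_absorbed {π : List (Clause V)}
    (hπ : IsResolutionDerivation φ.toCnf π) (hb : 1 ≤ b) (hφ : φ.XorWidthLE b) :
    ∀ n ≤ π.length, Reaches M φ eager [] φ.clauses
      (n * (2 * φ.vars.card * learnBound b φ.vars.card)) fun db =>
        ∀ (i : ℕ) (hi : i < π.length), i < n →
          Absorbed M φ.xors db π[i] ∧ ∀ m ∈ π[i], m.var ∈ φ.vars := by
  intro n
  induction n with
  | zero =>
    refine fun _ => ⟨[], φ.clauses, 0, Nat.zero_le _, ⟨.nil, by simp [Trail.DecisionFree],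
      fun C hC => CnfXor.var_mem_of_mem_toCnf (Finset.mem_union_left _ hC)⟩, subset_rfl,
      by simp, .refl _⟩
  | succ n ih =>
    intro hn
    rw [Nat.succ_mul]
    refine (ih (Nat.le_of_succ_le hn)).trans fun t db hr hdb hP => ?_
    have hstep : Conflicts M φ.xors db (Clause.negs π[n]) ∧ ∀ m ∈ π[n], m.var ∈ φ.vars := by
      rcases hπ n hn with hF | ⟨j, k, hj, hk, x, hxj, hxk, hres⟩
      · refine ⟨?_, CnfXor.var_mem_of_mem_toCnf hF⟩
        rcases Finset.mem_union.1 hF with hC | hC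
        · exact (absorbed_of_mem (hdb hC)).1
        · obtain ⟨D, hD, hC⟩ := Finset.mem_biUnion.1 hC
          exact (absorbed_of_mem_cnf hD hC).1
      · obtain ⟨haj, hvj⟩ := hP j _ hj
        obtain ⟨hak, hvk⟩ := hP k _ hk
        rw [hres]
        refine ⟨haj.conflicts_resolvent hak hxj hxk, fun m hm => ?_⟩
        rcases Finset.mem_union.1 hm with hm | hm
        · exact hvj m (Finset.mem_of_mem_erase hm)
        · exact hvk m (Finset.mem_of_mem_erase hm)
    obtain ⟨t', db', s, hs, hr', hdb', hA, hrun⟩ :=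
      hr.reaches_absorbed (eager := eager) hb hφ hstep.2 hstep.1
    refine ⟨t', db', s, hs, hr', hdb', fun i hi hin => ?_, hrun⟩
    rcases Nat.lt_succ_iff_lt_or_eq.1 hin with hin | rfl
    · exact ⟨(hP i hi hin).1.mono hdb', (hP i hi hin).2⟩
    · exact ⟨hA, hstep.2⟩

/-- If propagation without assumptions leads to a conflict, the solver answers "unsatisfiable". -/
theorem Ready.exists_run_unsat (h : Ready M φ t db) (hb : 1 ≤ b) (hφ : φ.XorWidthLE b)
    (hc : Conflicts M φ.xors db ∅) :
    ∃ s ≤ learnBound b φ.vars.card, Run M φ eager (.search t db) s .unsat := by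
  obtain ⟨p, s, hp, hg, hs, hr⟩ := h.trail.exists_saturate (eager := eager) h.db hb hφ
  rcases hr with ⟨hsat, -⟩ | ⟨K, hr, hf, hK⟩
  · exact absurd (hc.mono subset_rfl (Set.empty_subset _)) (hsat.not_conflicts hg hb hφ)
  have hg' : GoodTrail M φ db ((p ++ t) ++ []) := by simpa using hg
  obtain ⟨K', hr', hf', -⟩ := hg'.exists_analyze (eager := eager) (K := K) (fun e he =>
    (List.mem_append.1 he).elim (hp e) (h.decisionFree e)) (by simpa using hf) hK
  have hK' : K' = ∅ := Finset.eq_empty_of_forall_notMem fun m hm => by simpa using hf' m hm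
  rw [List.append_nil, hK'] at hr'
  refine ⟨s + ((p ++ t).length + 1), ?_, hr.trans (hr'.trans (Step.run (.fail _ _)))⟩
  have hlen := hg.length_le
  have hlen' := hlen
  rw [List.length_append] at hlen'
  rw [learnBound]
  generalize reportBound b φ.vars.card = B at *
  generalize φ.vars.card = n at *
  calc _ ≤ (p.length + 1) * (B + 1) + (n + 1) := by omega
    _ ≤ (n + 1) * (B + 1) + (n + 1) :=
      Nat.add_le_add_right (Nat.mul_le_mul_right _ (by omega)) _
    _ ≤ (n + 2) * (B + 3) := by nlinarith

theorem ResolutionRefutes.exists_dpllXorRefutes {s : ℕ} (hb : 1 ≤ b) (hφ : φ.XorWidthLE b)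
    (h : ResolutionRefutes φ.toCnf s) :
    ∃ s' ≤ s * (2 * φ.vars.card * learnBound b φ.vars.card) + learnBound b φ.vars.card,
      DpllXorRefutes M eager φ s' := by
  obtain ⟨π, hπ, hempty, rfl⟩ := h
  obtain ⟨t, db, s, hs, hr, -, hA, hrun⟩ :=
    hπ.reaches_absorbed (M := M) (eager := eager) hb hφ π.length le_rfl
  obtain ⟨i, hi, h0⟩ := List.getElem_of_mem hempty
  have hc : Conflicts M φ.xors db ∅ := by
    have := (hA i hi hi).1.1
    rw [h0] at this
    exact this.mono subset_rfl fun m hm => by simp [Clause.negs] at hm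
  obtain ⟨s', hs', hrun'⟩ := hr.exists_run_unsat (eager := eager) hb hφ hc
  exact ⟨s + s', Nat.add_le_add hs hs', hrun.trans hrun'⟩

theorem CnfXor.card_vars_le_size (φ : CnfXor V) : φ.vars.card ≤ φ.size := by
  refine (Finset.card_union_le _ _).trans (Nat.add_le_add ?_ ?_)
  · refine Finset.card_biUnion_le.trans (Finset.sum_le_sum fun C _ => ?_)
    exact Finset.card_image_le.trans (Nat.le_add_left _ _)
  · exact Finset.card_biUnion_le.trans (Finset.sum_le_sum fun D _ => Nat.le_add_left _ _)

theorem learnBound_mono (b : ℕ) {n n' : ℕ} (h : n ≤ n') : learnBound b n ≤ learnBound b n' := by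
  unfold learnBound reportBound
  gcongr

end Learning

end DpllXor

theorem mainTheorem6 (w : ℕ) :
    ∃ p : Polynomial ℕ, ∀ (V : Type*) [DecidableEq V] (M : DpllXor.XorModule) (eager : Bool)
      (φ : DpllXor.CnfXor V), φ.XorWidthLE w →
      (∀ s : ℕ, DpllXor.DpllXorRefutes M eager φ s →
        ∃ s' : ℕ, s' ≤ p.eval (φ.size + s) ∧ DpllXor.ResolutionRefutes φ.toCnf s') ∧
      (∀ s : ℕ, DpllXor.ResolutionRefutes φ.toCnf s →
        ∃ s' : ℕ, s' ≤ p.eval (φ.size + s) ∧ DpllXor.DpllXorRefutes M eager φ s') := by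
  let X : Polynomial ℕ := Polynomial.X
  -- the bound `DpllXor.learnBound (w + 1)` as a polynomial
  let E : Polynomial ℕ := (X + 2) * (2 * (X + 1) ^ (w + 1) * (2 * X + 3) + 3)
  have hE : ∀ N, E.eval N = DpllXor.learnBound (w + 1) N := fun N => by
    simp [E, X, DpllXor.learnBound, DpllXor.reportBound]
  refine ⟨(2 ^ w + 2 ^ (3 * (w + 2))) * X + (X * (2 * X * E) + E), fun V _ M eager φ hφ => ?_⟩
  have heval : ∀ N, ((2 ^ w + 2 ^ (3 * (w + 2))) * X + (X * (2 * X * E) + E)).eval N =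
      (2 ^ w + 2 ^ (3 * (w + 2))) * N + (N * (2 * N * DpllXor.learnBound (w + 1) N) +
        DpllXor.learnBound (w + 1) N) := fun N => by
    simp [hE, X]
  simp only [heval]
  refine ⟨fun s h => ?_, fun s h => ?_⟩
  · obtain ⟨s', hs', h'⟩ := DpllXor.DpllXorRefutes.exists_resolutionRefutes hφ h
    refine ⟨s', hs'.trans (le_trans ?_ (Nat.le_add_right _ _)), h'⟩
    rw [Nat.add_mul]
    gcongr <;> omega
  · obtain ⟨s', hs', h'⟩ := DpllXor.ResolutionRefutes.exists_dpllXorRefutes (M := M)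
      (eager := eager) (Nat.le_add_left 1 w) (fun D hD => (hφ D hD).trans (Nat.le_succ w)) h
    refine ⟨s', hs'.trans (le_trans ?_ (Nat.le_add_left _ _)), h'⟩
    have h1 : φ.vars.card ≤ φ.size + s := φ.card_vars_le_size.trans (Nat.le_add_right _ _)
    have h2 := DpllXor.learnBound_mono (w + 1) h1
    gcongr
    omega
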